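/- Fix $\gamma\in[0,1)$, $\alpha$ with $\frac{1+\gamma}{2}<\alpha<1$, and $r\ge 0$. Consider sequences of integers $p,N,s$ with $N\to\infty$ and $N=p^{1-\gamma}$, $s=p^{1-\alpha}$ up to rounding to integers, i.e. $|N-p^{1-\gamma}|<1$ and $|s-p^{1-\alpha}|<1$. One observes $y=X\beta+z\in\mathbb{C}^N$, where $X\in\mathbb{C}^{N\times p}$ is the extended discrete Fourier transform matrix $$X_{jk}=\frac{1}{\sqrt p}\,e^{-2\pi i(k-1)(j-1)/p},\qquad 1\le j\le N,\ 1\le k\le p,$$ $\beta\in\mathbb{C}^p$, and the coordinates of $z$ are independent standard circularly-symmetric complex normal variables (independent real and imaginary parts, each $\mathcal N(0,\frac12)$). Let $\mathbb{P}_0$ be the law of $y$ when $\beta=0$. For $1\le\tau_1<\dots<\tau_s\le p$ and $\tilde\beta\in\mathbb{C}^s$, let $\mathbb{P}_{(\tau,\tilde\beta)}$ be the law of $y$ when $\beta_{\tau_l}=\tilde\beta_l$ for $l=1,\dots,s$ and all other coordinates of $\beta$ are $0$. Put $\tau_{s+1}:=\tau_1+p$ and $$\Delta(\tau)=\frac1p\min_{1\le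 l\le s}|\tau_{l+1}-\tau_l|,\qquad \Gamma(p,N,s,r)=\Bigl\{(\tau,\tilde\beta): |\tilde\beta_1|=\dots=|\tilde\beta_s|=\sqrt{\tfrac{r\,p\log p}{N}},\ \Delta(\tau)\ge\tfrac{\log^2N}{N}\Bigr\}.$$ Let $$\rho_\gamma^*(\alpha)=\begin{cases}(\sqrt{1-\gamma}-\sqrt{1-\alpha})^2,&\frac34+\frac\gamma4\le\alpha<1,\\[2pt] \alpha-\frac12-\frac\gamma2,&\frac{1+\gamma}2\le\alpha<\frac34+\frac\gamma4.\end{cases}$$ For a (possibly randomized) test $\varphi$ of $H_0:\beta=0$ based on $y$, write $$R(\varphi)=\mathbb{P}_0(H_0\text{ is rejected})+\sup_{(\tau,\tilde\beta)\in\Gamma(p,N,s,r)}\mathbb{P}_{(\tau,\tilde\beta)}(H_0\text{ is accepted}).$$ If $r<\rho_\gamma^*(\alpha)$, then all sequences of tests are asymptotically powerless: every sequence of tests $\varphi_N$ satisfies $\liminf_{N\to\infty}R(\varphi_N)\ge 1$, so that $\lim_{N\to\infty}R(\varphi_N)=1$ whenever $\limsup_{N\to\infty}R(\varphi_N)\le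 1$; and the minimal risk satisfies $\lim_{N\to\infty}\inf_{\varphi}R(\varphi)=1$, the infimum being over all tests. -/

import Mathlib

open MeasureTheory ProbabilityTheory Filter Topology

namespace EDFT

noncomputable section

/-- The `N × p` extended discrete Fourier transform matrix. Rows and columns are numbered from
`0`, so `(j, k)` here is `(j + 1, k + 1)` in one-based numbering. -/
def designMatrix (N p : ℕ) : Matrix (Fin N) (Fin p) ℂ :=
  Matrix.of fun j k =>
    ((1 / Real.sqrt (p : ℝ) : ℝ) : ℂ) *
      Complex.exp (-(2 * (Real.pi : ℂ) * Complex.I * ((k : ℕ) : ℂ) * ((j : ℕ) : ℂ)) / (p : ℂ))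

/-- The standard circularly-symmetric complex normal law `CN(0, 1, 0)` on `ℂ`: real and imaginary
parts are independent centred normals of variance `1 / 2`. -/
def stdComplexNormal : Measure ℂ :=
  ((gaussianReal 0 (1 / 2)).prod (gaussianReal 0 (1 / 2))).map
    fun x : ℝ × ℝ => (x.1 : ℂ) + (x.2 : ℂ) * Complex.I

/-- The law of the noise vector: `N` independent standard complex normal coordinates. -/
def noiseLaw (N : ℕ) : Measure (Fin N → ℂ) :=
  Measure.pi fun _ => stdComplexNormal

/-- The law of the observation `y = X β + z`. -/
def obsLaw (N p : ℕ) (β : Fin p → ℂ) : Measure (Fin N → ℂ) :=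
  (noiseLaw N).map fun z => (designMatrix N p).mulVec β + z

/-- The coefficient vector with entries `b l` at the (distinct) positions `τ l`, and `0`
elsewhere. -/
def signal {p s : ℕ} (τ : Fin s → Fin p) (b : Fin s → ℂ) : Fin p → ℂ :=
  fun k => ∑ l : Fin s, if τ l = k then b l else 0

/-- The index that follows `τ l` cyclically: `τ (l + 1)`, and `τ 0 + p` after the last one. -/
def nextIndex {p s : ℕ} (τ : Fin s → Fin p) (l : Fin s) : ℕ :=
  if h : (l : ℕ) + 1 < s then (τ ⟨(l : ℕ) + 1, h⟩ : ℕ)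
  else (τ ⟨0, Nat.zero_lt_of_lt l.isLt⟩ : ℕ) + p

/-- The minimum separation `Δ(τ)`. -/
def minSeparation {p s : ℕ} (τ : Fin s → Fin p) : ℝ :=
  (1 / (p : ℝ)) * ⨅ l : Fin s, |((nextIndex τ l : ℕ) : ℝ) - ((τ l : ℕ) : ℝ)|

/-- The parameter space `Γ(p, N, s, r)` of pairs (increasing support, values on the support). -/
def paramSpace (p N s : ℕ) (r : ℝ) : Set ((Fin s → Fin p) × (Fin s → ℂ)) :=
  {x | StrictMono x.1 ∧
    (∀ l, ‖x.2 l‖ = Real.sqrt (r * (p : ℝ) * Real.log (p : ℝ) / (N : ℝ))) ∧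
    Real.log (N : ℝ) ^ 2 / (N : ℝ) ≤ minSeparation x.1}

/-- A (possibly randomized) test based on `y ∈ ℂ^N`: the value at `y` is the probability with which
`H₀` is rejected when `y` is observed. Non-randomized tests are the `{0, 1}`-valued ones. -/
structure Test (N : ℕ) where
  /-- the rejection probability given the observation -/
  reject : (Fin N → ℂ) → ℝ
  measurable_reject : Measurable reject
  reject_mem : ∀ y, reject y ∈ Set.Icc (0 : ℝ) 1

/-- The type I error: the probability of rejecting `H₀` under `β = 0`. -/
def typeIError {N : ℕ} (p : ℕ) (φ : Test N) : ℝ :=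
  ∫ y, φ.reject y ∂(obsLaw N p 0)

/-- The worst-case type II error: the supremum over the parameter space of the probability of
accepting `H₀`. -/
def typeIIError {N : ℕ} (p s : ℕ) (r : ℝ) (φ : Test N) : ℝ :=
  ⨆ x : paramSpace p N s r, ∫ y, (1 - φ.reject y) ∂(obsLaw N p (signal x.1.1 x.1.2))

/-- Type I error plus worst-case type II error. -/
def risk {N : ℕ} (p s : ℕ) (r : ℝ) (φ : Test N) : ℝ :=
  typeIError p φ + typeIIError p s r φ

/-- The detection boundary `ρ*_γ(α)`, for `(1 + γ) / 2 ≤ α < 1`. -/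
def rhoStar (γ α : ℝ) : ℝ :=
  if 3 / 4 + γ / 4 ≤ α then (Real.sqrt (1 - γ) - Real.sqrt (1 - α)) ^ 2
  else α - 1 / 2 - γ / 2

end

end EDFT

/-! ### Schur test and complementary factors -/

namespace EDFT

open scoped Matrix ComplexOrder MatrixOrder

/-! The worst-case error dominates the average error over any prior, so a least favourable prior
suffices. Cut an initial stretch of the index range into `s` blocks of `m` cells with mesh `D`, and
put one spike of fixed positive amplitude at a uniformly chosen cell of each block, independently
over blocks. The mesh itself enforces the separation condition.

The columns of the design at the grid points are nearly orthogonal: by the Dirichlet kernel bound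
and a harmonic sum, the off-diagonal row sums of their Gram matrix are at most `η` times the
diagonal entry (`gridMatrix_schur`). Divided by `√c`, with `c = (N / p) * (1 + η)`, they form a
contraction `C`, so `C * Cᴴ + R * Rᴴ = 1` for some `R`, and the noise has the law of `C g + R g'`
with independent standard `g`, `g'` (`map_blockNoise_prod_noiseLaw`). Hence the observation is a
randomized function of a Gaussian sequence model `θ + g` with independent coordinates, where each
spike has size `a = √(r (1 + η) log p)`. Detection from `y` cannot be easier than detection there,
and `η` is arbitrarily small.

In the sequence model the mixture likelihood ratio is a product over blocks of averages over cells.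
Truncating each factor at real part `t` lowers its mean to no less than `1 - exp (-(t - a)^2)` and
keeps its second moment under control. If the truncated ratio `L` tends to 1 in L², the Bayes risk,
at least `1 - ∫ |1 - L|`, tends to 1 (`one_sub_sqrt_le_typeIError_add`).

Take `t = u √(log p)`, with `u² = 1 - γ`, `v² = 1 - α`, `w² = r (1 + η)`. The lost mass is of order
`p ^ (v² - (u - w)²)`. Up to an arbitrarily small exponent, the second-moment excess is governed by
`p ^ (2v² - u² + 2w²)` if `2w ≤ u` and by `p ^ (2v² - 2(u - w)²)` otherwise. Negativity of these
exponents is what the two branches of the detection boundary guarantee (`lt_rhoStar_imp`,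
`exists_chernoff_exponent_neg`). The resulting error does not depend on the test, so it bounds the
minimal risk as well. -/

lemma star_dotProduct_self_eq_sum {ι : Type*} [Fintype ι] (u : ι → ℂ) :
    star u ⬝ᵥ u = ((∑ i, ‖u i‖ ^ 2 : ℝ) : ℂ) := by
  simp only [dotProduct, Pi.star_apply, Complex.ofReal_sum]
  refine Finset.sum_congr rfl fun i _ => ?_
  rw [Complex.star_def, Complex.conj_mul', Complex.ofReal_pow]

/-- The Schur test for the Gram matrix. -/
lemma sum_norm_sq_mulVec_le {ι κ : Type*} [Fintype ι] [Fintype κ] (C : Matrix ι κ ℂ)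
    (hC : ∀ k, ∑ l, ‖(Cᴴ * C) k l‖ ≤ 1) (u : κ → ℂ) :
    ∑ j, ‖(C *ᵥ u) j‖ ^ 2 ≤ ∑ k, ‖u k‖ ^ 2 := by
  have hsymm : ∀ k l, ‖(Cᴴ * C) k l‖ = ‖(Cᴴ * C) l k‖ := fun k l => by
    rw [← (Matrix.isHermitian_conjTranspose_mul_self C).apply k l, norm_star]
  have h1 : ((∑ j, ‖(C *ᵥ u) j‖ ^ 2 : ℝ) : ℂ) = ∑ k, ∑ l, star (u k) * (Cᴴ * C) k l * u l := by
    rw [← star_dotProduct_self_eq_sum, Matrix.star_mulVec, ← Matrix.dotProduct_mulVec,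
      Matrix.mulVec_mulVec]
    simp [dotProduct, Matrix.mulVec, Finset.mul_sum, mul_assoc]
  have h2 : ∑ j, ‖(C *ᵥ u) j‖ ^ 2 ≤ ∑ k, ∑ l, ‖(Cᴴ * C) k l‖ * (‖u k‖ ^ 2 / 2 + ‖u l‖ ^ 2 / 2) := by
    have h3 : ∑ j, ‖(C *ᵥ u) j‖ ^ 2 = ‖((∑ j, ‖(C *ᵥ u) j‖ ^ 2 : ℝ) : ℂ)‖ := by
      rw [Complex.norm_real, Real.norm_of_nonneg (by positivity)]
    rw [h3, h1]
    refine (norm_sum_le _ _).trans (Finset.sum_le_sum fun k _ => (norm_sum_le _ _).trans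
      (Finset.sum_le_sum fun l _ => ?_))
    rw [norm_mul, norm_mul, norm_star]
    nlinarith [norm_nonneg ((Cᴴ * C) k l), mul_nonneg (norm_nonneg ((Cᴴ * C) k l))
      (sq_nonneg (‖u k‖ - ‖u l‖))]
  refine h2.trans ?_
  have h4 : ∑ k, ∑ l, ‖(Cᴴ * C) k l‖ * (‖u k‖ ^ 2 / 2 + ‖u l‖ ^ 2 / 2) =
      ∑ k, (∑ l, ‖(Cᴴ * C) k l‖) * ‖u k‖ ^ 2 := by
    simp only [mul_add, Finset.sum_add_distrib]
    rw [Finset.sum_comm (f := fun k l => ‖(Cᴴ * C) k l‖ * (‖u l‖ ^ 2 / 2)), ← Finset.sum_add_distrib]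
    refine Finset.sum_congr rfl fun k _ => ?_
    rw [← Finset.sum_add_distrib, Finset.sum_mul]
    refine Finset.sum_congr rfl fun l _ => ?_
    rw [hsymm l k]
    ring
  rw [h4]
  exact Finset.sum_le_sum fun k _ => mul_le_of_le_one_left (by positivity) (hC k)

/-- The adjoint of a contraction is a contraction: pair `b` with `C Cᴴ b`, apply Cauchy–Schwarz, and
cancel one factor of `‖Cᴴ b‖²`. -/
lemma sum_norm_sq_conjTranspose_mulVec_le {ι κ : Type*} [Fintype ι] [Fintype κ] (C : Matrix ι κ ℂ)
    (hC : ∀ k, ∑ l, ‖(Cᴴ * C) k l‖ ≤ 1) (b : ι → ℂ) :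
    ∑ k, ‖(Cᴴ *ᵥ b) k‖ ^ 2 ≤ ∑ j, ‖b j‖ ^ 2 := by
  set u := Cᴴ *ᵥ b with hu
  set T := ∑ k, ‖u k‖ ^ 2 with hT
  have hT0 : 0 ≤ T := by positivity
  have h1 : (T : ℂ) = star b ⬝ᵥ (C *ᵥ u) := by
    rw [hT, ← star_dotProduct_self_eq_sum]
    conv_lhs => rw [hu, Matrix.star_mulVec, Matrix.conjTranspose_conjTranspose,
      ← Matrix.dotProduct_mulVec]
  have h2 : T ≤ ∑ j, ‖b j‖ * ‖(C *ᵥ u) j‖ := by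
    have : T = ‖(T : ℂ)‖ := by rw [Complex.norm_real, Real.norm_of_nonneg hT0]
    rw [this, h1, dotProduct]
    refine (norm_sum_le _ _).trans (Finset.sum_le_sum fun j _ => ?_)
    rw [norm_mul, Pi.star_apply, norm_star]
  have h3 : T ^ 2 ≤ (∑ j, ‖b j‖ ^ 2) * T := by
    calc T ^ 2 ≤ (∑ j, ‖b j‖ * ‖(C *ᵥ u) j‖) ^ 2 := by gcongr
      _ ≤ (∑ j, ‖b j‖ ^ 2) * ∑ j, ‖(C *ᵥ u) j‖ ^ 2 := Finset.sum_mul_sq_le_sq_mul_sq _ _ _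
      _ ≤ _ := by
        gcongr
        exact sum_norm_sq_mulVec_le C hC u
  rcases hT0.eq_or_lt with h | h
  · rw [← h]; positivity
  · nlinarith

/-- If the Gram matrix of `C` passes the Schur test, then `C` is a contraction, so the identity
is completed by a complementary factor. -/
lemma exists_mul_conjTranspose_add_eq_one {ι κ : Type*} [Fintype ι] [DecidableEq ι] [Fintype κ]
    (C : Matrix ι κ ℂ) (hC : ∀ k, ∑ l, ‖(Cᴴ * C) k l‖ ≤ 1) :
    ∃ R : Matrix ι ι ℂ, C * Cᴴ + R * Rᴴ = 1 := by
  have hpsd : (1 - C * Cᴴ).PosSemidef := by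
    refine Matrix.PosSemidef.of_dotProduct_mulVec_nonneg
      (Matrix.isHermitian_one.sub (Matrix.isHermitian_mul_conjTranspose_self C)) fun b => ?_
    have h : star b ⬝ᵥ ((1 - C * Cᴴ) *ᵥ b) =
        ((∑ j, ‖b j‖ ^ 2 - ∑ k, ‖(Cᴴ *ᵥ b) k‖ ^ 2 : ℝ) : ℂ) := by
      rw [Matrix.sub_mulVec, Matrix.one_mulVec, dotProduct_sub, Complex.ofReal_sub,
        ← star_dotProduct_self_eq_sum, ← star_dotProduct_self_eq_sum, Matrix.star_mulVec,
        Matrix.conjTranspose_conjTranspose, ← Matrix.dotProduct_mulVec, Matrix.mulVec_mulVec]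
    rw [h]
    exact_mod_cast sub_nonneg.2 (sum_norm_sq_conjTranspose_mulVec_le C hC b)
  obtain ⟨B, hB⟩ := CStarAlgebra.nonneg_iff_eq_star_mul_self.mp hpsd.nonneg
  refine ⟨Bᴴ, ?_⟩
  rw [Matrix.conjTranspose_conjTranspose, ← Matrix.star_eq_conjTranspose, ← hB]
  abel

/-! ### Dirichlet kernel and the Gram matrix of the grid columns -/

/-- The bound for exponential sums that underlies the Dirichlet kernel. -/
lemma norm_sum_exp_le (N : ℕ) {x : ℝ} (hx0 : x ≠ 0) (hx : |x| ≤ 1 / 2) :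
    ‖∑ j ∈ Finset.range N, Complex.exp (Complex.I * ((2 * Real.pi * x : ℝ) : ℂ)) ^ j‖ ≤
      1 / (2 * |x|) := by
  have hxp : 0 < |x| := abs_pos.2 hx0
  set w := Complex.exp (Complex.I * ((2 * Real.pi * x : ℝ) : ℂ)) with hw
  have hw1 : ‖w‖ = 1 := by rw [hw, mul_comm, Complex.norm_exp_ofReal_mul_I]
  -- Here `‖w - 1‖ = 2 |sin (π x)|`, and Jordan's inequality applies because `|x| ≤ 1 / 2`.
  have h1 : 4 * |x| ≤ ‖w - 1‖ := by
    rw [hw, Complex.norm_exp_I_mul_ofReal_sub_one, norm_mul, Real.norm_eq_abs, Real.norm_eq_abs,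
      abs_two, show 2 * Real.pi * x / 2 = Real.pi * x by ring]
    have hpi := Real.pi_pos
    have := Real.mul_abs_le_abs_sin (x := Real.pi * x) (by
      rw [abs_mul, abs_of_pos hpi]; nlinarith)
    rw [abs_mul, abs_of_pos hpi] at this
    have h2 : 2 / Real.pi * (Real.pi * |x|) = 2 * |x| := by field_simp
    linarith
  have hne : w ≠ 1 := fun h => by
    rw [h, sub_self, norm_zero] at h1
    linarith
  rw [geom_sum_eq hne, norm_div]
  have h2 : ‖w ^ N - 1‖ ≤ 2 := by
    refine (norm_sub_le _ _).trans ?_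
    rw [norm_pow, hw1, one_pow, norm_one]
    norm_num
  calc ‖w ^ N - 1‖ / ‖w - 1‖ ≤ 2 / (4 * |x|) := by gcongr
    _ = 1 / (2 * |x|) := by field_simp; norm_num

lemma sum_inv_abs_sub_le (M : ℕ) (n : ℕ) (hn : n < M) :
    ∑ k ∈ (Finset.range M).erase n, 1 / |(k : ℝ) - n| ≤ 2 * (1 + Real.log M) := by
  have hH : ∀ K ≤ M, ∑ d ∈ Finset.range K, 1 / ((d : ℝ) + 1) ≤ 1 + Real.log M := fun K hK => by
    calc ∑ d ∈ Finset.range K, 1 / ((d : ℝ) + 1) ≤ ∑ d ∈ Finset.range M, 1 / ((d : ℝ) + 1) :=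
          Finset.sum_le_sum_of_subset_of_nonneg (Finset.range_mono hK) fun _ _ _ => by positivity
      _ = ((harmonic M : ℚ) : ℝ) := by simp [harmonic]
      _ ≤ _ := harmonic_le_one_add_log M
  have hsplit : (Finset.range M).erase n = Finset.range n ∪ Finset.Ico (n + 1) M := by
    ext k; simp; omega
  have hdisj : Disjoint (Finset.range n) (Finset.Ico (n + 1) M) := by
    rw [Finset.disjoint_left]; intro k; simp; omega
  rw [hsplit, Finset.sum_union hdisj, two_mul]
  refine add_le_add ?_ ?_
  · rw [← Finset.sum_range_reflect]
    refine le_of_eq_of_le (Finset.sum_congr rfl fun d hd => ?_) (hH n hn.le)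
    have hd := Finset.mem_range.1 hd
    rw [Nat.cast_sub (by omega), Nat.cast_sub (by omega), abs_sub_comm, abs_of_nonneg] <;>
      push_cast <;> [ring; linarith [(Nat.cast_nonneg d : (0 : ℝ) ≤ d)]]
  · rw [Finset.sum_Ico_eq_sum_range]
    refine le_of_eq_of_le (Finset.sum_congr rfl fun d hd => ?_) (hH (M - (n + 1)) (by omega))
    rw [abs_of_nonneg] <;> push_cast <;> [ring; linarith [(Nat.cast_nonneg d : (0 : ℝ) ≤ d)]]

/-- The grid position of cell `q.2` in block `q.1`, for blocks of `m` cells and mesh `D`. -/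
def gridPos {s m : ℕ} (D : ℕ) (q : Fin s × Fin m) : ℕ := D * ((q.2 : ℕ) + m * (q.1 : ℕ))

lemma gridPos_lt {s m D p : ℕ} (hD : 0 < D) (h : s * m * D ≤ p) (q : Fin s × Fin m) :
    gridPos D q < p := by
  have h1 : (q.2 : ℕ) + m * (q.1 : ℕ) < s * m := (finProdFinEquiv q).isLt
  calc D * ((q.2 : ℕ) + m * (q.1 : ℕ)) < D * (s * m) := Nat.mul_lt_mul_of_pos_left h1 hD
    _ ≤ p := by rw [mul_comm]; exact h

/-- The columns of the design matrix at the grid positions, divided by `√c`. -/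
noncomputable def gridMatrix (N p s m D : ℕ) (c : ℝ) : Matrix (Fin N) (Fin s × Fin m) ℂ :=
  Matrix.of fun j q =>
    ((1 / Real.sqrt c * (1 / Real.sqrt (p : ℝ)) : ℝ) : ℂ) *
      Complex.exp (-(2 * (Real.pi : ℂ) * Complex.I * ((gridPos D q : ℕ) : ℂ) * ((j : ℕ) : ℂ)) /
        (p : ℂ))

lemma gridMatrix_gram (N p s m D : ℕ) {c : ℝ} (hc : 0 < c) (q q' : Fin s × Fin m) :
    ((gridMatrix N p s m D c)ᴴ * gridMatrix N p s m D c) q q' =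
      ((1 / (c * p) : ℝ) : ℂ) * ∑ j ∈ Finset.range N, Complex.exp (Complex.I *
        ((2 * Real.pi * (((gridPos D q : ℝ) - gridPos D q') / p) : ℝ) : ℂ)) ^ j := by
  rw [Matrix.mul_apply, Finset.mul_sum, ← Fin.sum_univ_eq_sum_range
    (fun j => ((1 / (c * p) : ℝ) : ℂ) * Complex.exp (Complex.I *
        ((2 * Real.pi * (((gridPos D q : ℝ) - gridPos D q') / p) : ℝ) : ℂ)) ^ j)]
  refine Finset.sum_congr rfl fun j _ => ?_
  have h1 : (1 / (c * p) : ℝ) =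
      (1 / Real.sqrt c * (1 / Real.sqrt (p : ℝ))) * (1 / Real.sqrt c * (1 / Real.sqrt (p : ℝ))) := by
    have h2 := Real.mul_self_sqrt hc.le
    have h3 := Real.mul_self_sqrt (Nat.cast_nonneg p : (0 : ℝ) ≤ p)
    conv_lhs => rw [← h2, ← h3]
    simp only [one_div, mul_inv]
    ring
  simp only [Matrix.conjTranspose_apply, gridMatrix, Matrix.of_apply, star_mul', Complex.star_def,
    Complex.conj_ofReal, ← Complex.exp_conj]
  rw [h1, ← Complex.exp_nat_mul]
  generalize 1 / Real.sqrt c * (1 / Real.sqrt (p : ℝ)) = a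
  rw [Complex.ofReal_mul, mul_mul_mul_comm]
  congr 1
  rw [← Complex.exp_add]
  congr 1
  simp [show (starRingEnd ℂ) 2 = 2 from Complex.conj_ofNat 2]
  ring

/-- The Gram matrix of well-separated columns passes the Schur test. -/
lemma gridMatrix_schur {N p s m D : ℕ} {η : ℝ} (hη : 0 ≤ η) (hN : 0 < N) (hD : 0 < D) (hp : 0 < p)
    (hsm : 2 * (s * m * D) ≤ p)
    (hsep : (p : ℝ) / D * (1 + Real.log ((s * m : ℕ) : ℝ)) ≤ η * N) (q : Fin s × Fin m) :
    ∑ q', ‖((gridMatrix N p s m D ((N : ℝ) / p * (1 + η)))ᴴ *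
      gridMatrix N p s m D ((N : ℝ) / p * (1 + η))) q q'‖ ≤ 1 := by
  have hN' : (0 : ℝ) < N := by exact_mod_cast hN
  have hD' : (0 : ℝ) < D := by exact_mod_cast hD
  have hp' : (0 : ℝ) < p := by exact_mod_cast hp
  have hc : 0 < (N : ℝ) / p * (1 + η) := by positivity
  have hcp : (N : ℝ) / p * (1 + η) * p = N * (1 + η) := by field_simp
  set e : Fin s × Fin m ≃ Fin (s * m) := finProdFinEquiv with he
  have hpos : ∀ q', gridPos D q' = D * (e q' : ℕ) := fun q' => rfl
  -- With the blocks laid end to end, cells are numbered by one index `e q`, and two columns differ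
  -- in frequency by `D / p` times the index difference. The hypothesis `2 * (s * m * D) ≤ p` keeps
  -- this within `1 / 2`, with no wraparound.
  have key : ∀ q', ‖((gridMatrix N p s m D ((N : ℝ) / p * (1 + η)))ᴴ *
      gridMatrix N p s m D ((N : ℝ) / p * (1 + η))) q q'‖ ≤ 1 / (N * (1 + η)) *
      (if e q' = e q then (N : ℝ) else p / (2 * D) * (1 / |((e q' : ℕ) : ℝ) - (e q : ℕ)|)) := by
    intro q'
    rw [gridMatrix_gram N p s m D hc, hcp, norm_mul, Complex.norm_real,
      Real.norm_of_nonneg (by positivity)]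
    refine mul_le_mul_of_nonneg_left ?_ (by positivity)
    split_ifs with h
    · refine (norm_sum_le _ _).trans ?_
      simp [norm_pow, mul_comm Complex.I, -Complex.ofReal_mul, Complex.norm_exp_ofReal_mul_I]
    · have hne : ((e q : ℕ) : ℝ) - (e q' : ℕ) ≠ 0 := by
        rw [sub_ne_zero]
        intro h'
        exact h (Fin.ext (by exact_mod_cast h'.symm))
      have hx : ((gridPos D q : ℝ) - gridPos D q') / p = D / p * (((e q : ℕ) : ℝ) - (e q' : ℕ)) := by
        rw [hpos, hpos]; push_cast; ring
      rw [hx]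
      have hle : |((e q : ℕ) : ℝ) - (e q' : ℕ)| ≤ (s * m : ℕ) := by
        rw [abs_sub_le_iff]
        have h1 : ((e q : ℕ) : ℝ) ≤ (s * m : ℕ) := by exact_mod_cast (e q).isLt.le
        have h2 : ((e q' : ℕ) : ℝ) ≤ (s * m : ℕ) := by exact_mod_cast (e q').isLt.le
        constructor <;> linarith [(Nat.cast_nonneg (e q) : (0 : ℝ) ≤ (e q : ℕ)),
          (Nat.cast_nonneg (e q') : (0 : ℝ) ≤ (e q' : ℕ))]
      have habs : |(D : ℝ) / p * (((e q : ℕ) : ℝ) - (e q' : ℕ))| =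
          D / p * |((e q' : ℕ) : ℝ) - (e q : ℕ)| := by
        rw [abs_mul, abs_of_pos (by positivity), abs_sub_comm]
      refine (norm_sum_exp_le N (mul_ne_zero (by positivity) hne) ?_).trans (le_of_eq ?_)
      · rw [habs, abs_sub_comm, div_mul_eq_mul_div, div_le_iff₀ hp']
        have h2 : (2 : ℝ) * ((s * m : ℕ) * D) ≤ p := by exact_mod_cast hsm
        nlinarith
      · rw [habs]
        field_simp
  refine (Finset.sum_le_sum fun q' _ => key q').trans ?_
  rw [← Finset.mul_sum, e.sum_comp (fun k => if k = e q then (N : ℝ) else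
    p / (2 * D) * (1 / |((k : ℕ) : ℝ) - (e q : ℕ)|)), ← Finset.add_sum_erase _ _ (Finset.mem_univ (e q)),
    if_pos rfl]
  have hsum : ∑ k ∈ Finset.univ.erase (e q), (if k = e q then (N : ℝ) else
      p / (2 * D) * (1 / |((k : ℕ) : ℝ) - (e q : ℕ)|)) ≤ η * N := by
    have h1 : ∑ k ∈ Finset.univ.erase (e q), (if k = e q then (N : ℝ) else
        p / (2 * D) * (1 / |((k : ℕ) : ℝ) - (e q : ℕ)|)) =
        p / (2 * D) * ∑ k ∈ (Finset.range (s * m)).erase (e q), 1 / |(k : ℝ) - (e q : ℕ)| := by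
      rw [Finset.mul_sum]
      refine Finset.sum_bij (fun k _ => (k : ℕ)) ?_ ?_ ?_ ?_
      · intro k hk
        simpa [Fin.ext_iff] using Finset.ne_of_mem_erase hk
      · intro k _ l _ h
        exact Fin.ext h
      · intro k hk
        rw [Finset.mem_erase, Finset.mem_range] at hk
        exact ⟨⟨k, hk.2⟩, by simp [Fin.ext_iff, hk.1], rfl⟩
      · intro k hk
        rw [if_neg (Finset.ne_of_mem_erase hk)]
    rw [h1]
    calc (p : ℝ) / (2 * D) * ∑ k ∈ (Finset.range (s * m)).erase (e q), 1 / |(k : ℝ) - (e q : ℕ)|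
        ≤ p / (2 * D) * (2 * (1 + Real.log ((s * m : ℕ) : ℝ))) := by
          gcongr
          exact sum_inv_abs_sub_le _ _ (e q).isLt
      _ = (p : ℝ) / D * (1 + Real.log ((s * m : ℕ) : ℝ)) := by field_simp
      _ ≤ _ := hsep
  rw [one_div_mul_eq_div, div_le_one (by positivity)]
  linarith

end EDFT

/-! ### Gaussian shifts as densities -/

namespace EDFT

open scoped Matrix

lemma pi_withDensity {ι : Type*} [Fintype ι] {E : ι → Type*} {mE : ∀ i, MeasurableSpace (E i)}
    {μ : (i : ι) → Measure (E i)} [∀ i, IsProbabilityMeasure (μ i)]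
    {f : (i : ι) → E i → ENNReal} (hf : ∀ i, Measurable (f i))
    [∀ i, SigmaFinite ((μ i).withDensity (f i))] :
    Measure.pi (fun i => (μ i).withDensity (f i)) =
      (Measure.pi μ).withDensity (fun x => ∏ i, f i (x i)) := by
  refine Measure.pi_eq fun t ht => ?_
  rw [withDensity_apply _ (MeasurableSet.univ_pi ht), ← lintegral_indicator (MeasurableSet.univ_pi ht)]
  have h1 : (fun x : (i : ι) → E i => (Set.univ.pi t).indicator (fun x => ∏ i, f i (x i)) x) =
      fun x => ∏ i, (t i).indicator (f i) (x i) := by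
    classical
    funext x
    by_cases hx : x ∈ Set.univ.pi t
    · rw [Set.indicator_of_mem hx]
      exact Finset.prod_congr rfl fun i _ => (Set.indicator_of_mem (hx i (Set.mem_univ i)) _).symm
    · rw [Set.indicator_of_notMem hx]
      simp only [Set.mem_pi, Set.mem_univ, true_implies, not_forall] at hx
      obtain ⟨i, hi⟩ := hx
      exact (Finset.prod_eq_zero (Finset.mem_univ i) (Set.indicator_of_notMem hi _)).symm
  rw [h1, lintegral_prod_eq_prod_lintegral_of_indepFun Finset.univ
    (fun i (x : (i : ι) → E i) => (t i).indicator (f i) (x i))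
    (iIndepFun_pi (X := fun i => (t i).indicator (f i))
      fun i => ((hf i).indicator (ht i)).aemeasurable)
    (fun i => ((hf i).indicator (ht i)).comp (measurable_pi_apply i))]
  refine Finset.prod_congr rfl fun i _ => ?_
  rw [withDensity_apply _ (ht i), ← lintegral_indicator (ht i),
    ← (measurePreserving_eval μ i).lintegral_comp ((hf i).indicator (ht i))]

lemma map_withDensity_comp {α β : Type*} [MeasurableSpace α] [MeasurableSpace β] {μ : Measure α}
    {e : α → β} (he : Measurable e) {g : β → ENNReal} (hg : Measurable g) :
    (μ.withDensity (fun x => g (e x))).map e = (μ.map e).withDensity g := by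
  ext t ht
  rw [Measure.map_apply he ht, withDensity_apply _ (he ht), withDensity_apply _ ht,
    setLIntegral_map ht hg he]

/-- At variance `1 / 2` the density is proportional to `exp (-x²)`, so the ratio is `exp (x² - (x -
a)²)`. -/
lemma gaussianReal_half_map_const_add (a : ℝ) :
    (gaussianReal 0 (1 / 2)).map (fun x => a + x) =
      (gaussianReal 0 (1 / 2)).withDensity
        (fun x => ENNReal.ofReal (Real.exp (2 * a * x - a ^ 2))) := by
  have hv : (1 / 2 : NNReal) ≠ 0 := by norm_num
  rw [gaussianReal_map_const_add, zero_add, gaussianReal_of_var_ne_zero _ hv,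
    gaussianReal_of_var_ne_zero _ hv, ← withDensity_mul _ (measurable_gaussianPDF _ _) (by fun_prop)]
  congr 1
  funext x
  simp only [Pi.mul_apply, gaussianPDF_def]
  rw [← ENNReal.ofReal_mul (gaussianPDFReal_nonneg _ _ _)]
  simp only [gaussianPDFReal_def]
  rw [mul_assoc (Real.sqrt _)⁻¹, ← Real.exp_add]
  congr 3
  push_cast
  ring

lemma measurable_ofReal_add_mul_I :
    Measurable fun x : ℝ × ℝ => (x.1 : ℂ) + (x.2 : ℂ) * Complex.I := by fun_prop

instance isProbabilityMeasure_stdComplexNormal : IsProbabilityMeasure stdComplexNormal :=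
  Measure.isProbabilityMeasure_map measurable_ofReal_add_mul_I.aemeasurable

instance isProbabilityMeasure_noiseLaw (N : ℕ) : IsProbabilityMeasure (noiseLaw N) := by
  unfold noiseLaw; infer_instance

/-- The Cameron–Martin formula for a real shift of a standard complex normal variable. -/
lemma stdComplexNormal_map_const_add (a : ℝ) :
    stdComplexNormal.map (fun z => (a : ℂ) + z) =
      stdComplexNormal.withDensity
        (fun z => ENNReal.ofReal (Real.exp (2 * a * z.re - a ^ 2))) := by
  have hm := measurable_ofReal_add_mul_I
  have : SigmaFinite ((gaussianReal 0 (1 / 2)).withDensity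
      (fun x => ENNReal.ofReal (Real.exp (2 * a * x - a ^ 2)))) := by
    rw [← gaussianReal_half_map_const_add]
    have := Measure.isProbabilityMeasure_map (μ := gaussianReal 0 (1 / 2))
      (f := fun x => a + x) (by fun_prop)
    infer_instance
  unfold stdComplexNormal
  rw [← map_withDensity_comp hm (by fun_prop), Measure.map_map (by fun_prop) hm]
  have h1 : ((fun z : ℂ => (a : ℂ) + z) ∘ fun x : ℝ × ℝ => (x.1 : ℂ) + (x.2 : ℂ) * Complex.I) =
      (fun x : ℝ × ℝ => (x.1 : ℂ) + (x.2 : ℂ) * Complex.I) ∘ Prod.map (fun x => a + x) id := by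
    funext x; simp [add_assoc]
  rw [h1, ← Measure.map_map hm (by fun_prop), ← Measure.map_prod_map _ _ (by fun_prop) (by fun_prop),
    Measure.map_id, gaussianReal_half_map_const_add, prod_withDensity_left (by fun_prop)]
  congr 2
  funext x
  simp

lemma pi_stdComplexNormal_map_const_add {ι : Type*} [Fintype ι] (θ : ι → ℝ) :
    (Measure.pi fun _ : ι => stdComplexNormal).map (fun g i => (θ i : ℂ) + g i) =
      (Measure.pi fun _ : ι => stdComplexNormal).withDensity
        (fun g => ENNReal.ofReal (Real.exp (∑ i, (2 * θ i * (g i).re - θ i ^ 2)))) := by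
  have hprob : ∀ i, IsProbabilityMeasure (stdComplexNormal.map (fun z => (θ i : ℂ) + z)) :=
    fun i => Measure.isProbabilityMeasure_map (by fun_prop)
  have hsf : ∀ i, SigmaFinite (stdComplexNormal.withDensity
      (fun z => ENNReal.ofReal (Real.exp (2 * θ i * z.re - θ i ^ 2)))) := fun i => by
    rw [← stdComplexNormal_map_const_add]; infer_instance
  rw [Measure.pi_map_pi (f := fun i z => (θ i : ℂ) + z) fun i => by fun_prop]
  simp_rw [stdComplexNormal_map_const_add]
  rw [pi_withDensity fun i => by fun_prop]
  congr 1
  funext g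
  rw [Real.exp_sum, ENNReal.ofReal_prod_of_nonneg fun i _ => (Real.exp_pos _).le]

/-- Noise arranged in `s` blocks of `m` cells. -/
noncomputable def blockNoise (s m : ℕ) : Measure (Fin s → Fin m → ℂ) :=
  Measure.pi fun _ => Measure.pi fun _ => stdComplexNormal

instance isProbabilityMeasure_blockNoise (s m : ℕ) : IsProbabilityMeasure (blockNoise s m) := by
  unfold blockNoise; infer_instance

lemma blockNoise_map_const_add {s m : ℕ} (θ : Fin s → Fin m → ℝ) :
    (blockNoise s m).map (fun g b i => (θ b i : ℂ) + g b i) =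
      (blockNoise s m).withDensity (fun g =>
        ENNReal.ofReal (Real.exp (∑ b, ∑ i, (2 * θ b i * (g b i).re - θ b i ^ 2)))) := by
  have hmeas : ∀ b, Measurable fun (g : Fin m → ℂ) i => (θ b i : ℂ) + g i := fun b => by fun_prop
  have hprob : ∀ b, IsProbabilityMeasure ((Measure.pi fun _ : Fin m => stdComplexNormal).map
      (fun g i => (θ b i : ℂ) + g i)) :=
    fun b => Measure.isProbabilityMeasure_map (hmeas b).aemeasurable
  have hsf : ∀ b, SigmaFinite ((Measure.pi fun _ : Fin m => stdComplexNormal).withDensity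
      (fun g => ENNReal.ofReal (Real.exp (∑ i, (2 * θ b i * (g i).re - θ b i ^ 2))))) := fun b => by
    rw [← pi_stdComplexNormal_map_const_add]; infer_instance
  unfold blockNoise
  rw [Measure.pi_map_pi (f := fun b (g : Fin m → ℂ) i => (θ b i : ℂ) + g i)
    fun b => (hmeas b).aemeasurable]
  simp_rw [pi_stdComplexNormal_map_const_add]
  rw [pi_withDensity fun i => by fun_prop]
  congr 1
  funext g
  rw [Real.exp_sum, ENNReal.ofReal_prod_of_nonneg fun i _ => (Real.exp_pos _).le]

/-! ### Gaussian integrals and splitting of the noise -/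

lemma stdComplexNormal_map_re : stdComplexNormal.map Complex.re = gaussianReal 0 (1 / 2) := by
  unfold stdComplexNormal
  rw [Measure.map_map (by fun_prop) measurable_ofReal_add_mul_I]
  have : (Complex.re ∘ fun x : ℝ × ℝ => (x.1 : ℂ) + (x.2 : ℂ) * Complex.I) = Prod.fst := by
    funext x; simp
  rw [this]
  exact (measurePreserving_fst (μ := gaussianReal 0 (1 / 2)) (ν := gaussianReal 0 (1 / 2))).map_eq

lemma integrable_exp_mul_re_add (c d : ℝ) :
    Integrable (fun z : ℂ => Real.exp (c * z.re + d)) stdComplexNormal := by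
  have h := integrable_exp_mul_gaussianReal (μ := 0) (v := 1 / 2) c
  rw [← stdComplexNormal_map_re] at h
  simp_rw [Real.exp_add]
  exact (h.comp_measurable (by fun_prop)).mul_const _

lemma integral_exp_mul_re_add (c d : ℝ) :
    ∫ z : ℂ, Real.exp (c * z.re + d) ∂stdComplexNormal = Real.exp (c ^ 2 / 4 + d) := by
  have h : ∫ z : ℂ, Real.exp (c * z.re) ∂stdComplexNormal = Real.exp (c ^ 2 / 4) := by
    have h1 := mgf_gaussianReal (p := stdComplexNormal) stdComplexNormal_map_re c
    rw [mgf] at h1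
    rw [h1]
    congr 1
    push_cast
    ring
  simp_rw [Real.exp_add]
  rw [integral_mul_const, h]

/-- Circular symmetry: the characteristic function sees only `‖w‖`. This lets complex matrices act
on the noise through `C * Cᴴ` alone. -/
lemma integral_exp_re_mul_I (w : ℂ) :
    ∫ z : ℂ, Complex.exp (((w * z).re : ℝ) * Complex.I) ∂stdComplexNormal =
      Complex.exp (-((‖w‖ ^ 2 / 4 : ℝ) : ℂ)) := by
  unfold stdComplexNormal
  rw [integral_map measurable_ofReal_add_mul_I.aemeasurable
    (Measurable.aestronglyMeasurable (by fun_prop))]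
  have h1 : ∀ x : ℝ × ℝ,
      Complex.exp (((w * ((x.1 : ℂ) + (x.2 : ℂ) * Complex.I)).re : ℝ) * Complex.I) =
      Complex.exp (w.re * x.1 * Complex.I) * Complex.exp ((-w.im : ℝ) * x.2 * Complex.I) := by
    intro x
    rw [← Complex.exp_add]
    congr 1
    simp
    ring
  simp_rw [h1]
  rw [integral_prod_mul (fun x : ℝ => Complex.exp (w.re * x * Complex.I))
    (fun x : ℝ => Complex.exp ((-w.im : ℝ) * x * Complex.I)), ← charFun_apply_real,
    ← charFun_apply_real, charFun_gaussianReal, charFun_gaussianReal, ← Complex.exp_add,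
    Complex.sq_norm, Complex.normSq_apply]
  congr 1
  push_cast
  ring

lemma integral_exp_re_sum_mul_I {ι : Type*} [Fintype ι] (w : ι → ℂ) :
    ∫ z : ι → ℂ, Complex.exp (((∑ i, w i * z i).re : ℝ) * Complex.I)
      ∂(Measure.pi fun _ => stdComplexNormal) =
      Complex.exp (-((∑ i, ‖w i‖ ^ 2 / 4 : ℝ) : ℂ)) := by
  simp_rw [Complex.re_sum, Complex.ofReal_sum, Finset.sum_mul, Complex.exp_sum]
  rw [integral_fintype_prod_eq_prod (fun i z => Complex.exp (((w i * z).re : ℝ) * Complex.I))]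
  simp_rw [integral_exp_re_mul_I]
  rw [← Finset.sum_neg_distrib, Complex.exp_sum]

lemma integral_blockNoise_exp_re_sum_mul_I {s m : ℕ} (w : Fin s × Fin m → ℂ) :
    ∫ z : Fin s → Fin m → ℂ, Complex.exp (((∑ q, w q * Function.uncurry z q).re : ℝ) * Complex.I)
      ∂(blockNoise s m) =
      Complex.exp (-((∑ q, ‖w q‖ ^ 2 / 4 : ℝ) : ℂ)) := by
  unfold blockNoise
  simp_rw [Fintype.sum_prod_type, Function.uncurry]
  simp_rw [Complex.re_sum (Finset.univ : Finset (Fin s)), Complex.ofReal_sum, Finset.sum_mul,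
    Complex.exp_sum]
  rw [integral_fintype_prod_eq_prod (fun b (z : Fin m → ℂ) =>
    Complex.exp (((∑ i, w (b, i) * z i).re : ℝ) * Complex.I))]
  simp_rw [integral_exp_re_sum_mul_I]
  rw [← Finset.sum_neg_distrib, Complex.exp_sum]
  simp

lemma exists_dual_eq_re_sum {N : ℕ} (Λ : StrongDual ℝ (Fin N → ℂ)) :
    ∃ w : Fin N → ℂ, ∀ z, Λ z = (∑ j, w j * z j).re := by
  -- A real-linear functional is the real part of a complex-linear one; the coefficient is read off
  -- at `1` and at `I`, the latter with a minus sign since `Re (w I) = -Im w`.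
  refine ⟨fun j => (Λ (Pi.single j 1) : ℂ) - (Λ (Pi.single j Complex.I) : ℂ) * Complex.I,
    fun z => ?_⟩
  have h1 : z = ∑ j, ((z j).re • (Pi.single j 1 : Fin N → ℂ) +
      (z j).im • (Pi.single j Complex.I : Fin N → ℂ)) := by
    funext k
    simp only [Finset.sum_apply, Pi.add_apply, Pi.smul_apply, Pi.single_apply]
    rw [Finset.sum_eq_single k]
    · simp [Complex.re_add_im]
    · intro j _ hj
      simp [hj.symm]
    · simp
  conv_lhs => rw [h1]
  rw [map_sum, Complex.re_sum]
  refine Finset.sum_congr rfl fun j _ => ?_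
  rw [map_add, map_smul, map_smul]
  simp
  ring

/-- Complementary factors split the noise into independent parts. -/
lemma map_blockNoise_prod_noiseLaw {N s m : ℕ} {C : Matrix (Fin N) (Fin s × Fin m) ℂ}
    {R : Matrix (Fin N) (Fin N) ℂ} (hCR : C * Cᴴ + R * Rᴴ = 1) :
    ((blockNoise s m).prod (noiseLaw N)).map
      (fun x => C *ᵥ Function.uncurry x.1 + R *ᵥ x.2) = noiseLaw N := by
  have hmeas : Measurable fun x : (Fin s → Fin m → ℂ) × (Fin N → ℂ) =>
      C *ᵥ Function.uncurry x.1 + R *ᵥ x.2 := by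
    refine Continuous.measurable ?_
    refine Continuous.add (continuous_const.matrix_mulVec ?_)
      (continuous_const.matrix_mulVec continuous_snd)
    refine continuous_pi fun q => ?_
    simp only [Function.uncurry]
    fun_prop
  have := Measure.isProbabilityMeasure_map
    (μ := (blockNoise s m).prod (noiseLaw N)) hmeas.aemeasurable
  refine Measure.ext_of_charFunDual (funext fun Λ => ?_)
  obtain ⟨w, hw⟩ := exists_dual_eq_re_sum Λ
  rw [charFunDual_apply, charFunDual_apply, integral_map hmeas.aemeasurable
    (Measurable.aestronglyMeasurable (by fun_prop))]
  simp_rw [hw]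
  have hdot : ∀ x : (Fin s → Fin m → ℂ) × (Fin N → ℂ),
      (∑ j, w j * (C *ᵥ Function.uncurry x.1 + R *ᵥ x.2) j) =
      (∑ q, (w ᵥ* C) q * Function.uncurry x.1 q) + ∑ k, (w ᵥ* R) k * x.2 k := by
    intro x
    change w ⬝ᵥ _ = (w ᵥ* C) ⬝ᵥ _ + (w ᵥ* R) ⬝ᵥ _
    rw [dotProduct_add, Matrix.dotProduct_mulVec, Matrix.dotProduct_mulVec]
  simp_rw [hdot, Complex.add_re, Complex.ofReal_add, add_mul, Complex.exp_add]
  rw [integral_prod_mul (fun z : Fin s → Fin m → ℂ =>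
      Complex.exp (((∑ q, (w ᵥ* C) q * Function.uncurry z q).re : ℝ) * Complex.I))
    (fun z : Fin N → ℂ => Complex.exp (((∑ k, (w ᵥ* R) k * z k).re : ℝ) * Complex.I)),
    integral_blockNoise_exp_re_sum_mul_I]
  unfold noiseLaw
  rw [integral_exp_re_sum_mul_I, integral_exp_re_sum_mul_I, ← Complex.exp_add]
  -- The exponents become quadratic forms in `w`, which add up to that of `C * Cᴴ + R * Rᴴ = 1`.
  have hnorm : ∀ {κ : Type} [Fintype κ] (u : κ → ℂ),
      ((∑ k, ‖u k‖ ^ 2 / 4 : ℝ) : ℂ) = (u ⬝ᵥ star u) / 4 := by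
    intro κ _ u
    rw [dotProduct_comm, star_dotProduct_self_eq_sum, ← Finset.sum_div]
    push_cast
    rfl
  rw [hnorm, hnorm, hnorm, ← neg_add, ← add_div]
  congr 3
  rw [Matrix.star_vecMul, Matrix.star_vecMul, ← Matrix.dotProduct_mulVec, ← Matrix.dotProduct_mulVec,
    Matrix.mulVec_mulVec, Matrix.mulVec_mulVec, ← dotProduct_add, ← Matrix.add_mulVec, hCR,
    Matrix.one_mulVec]

/-! ### Truncated likelihood ratio in one cell -/

/-- The likelihood ratio of a shift by `a` of a standard complex normal variable, truncated to
real parts at most `t`. -/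
noncomputable def truncTilt (a t : ℝ) (z : ℂ) : ℝ :=
  if z.re ≤ t then Real.exp (2 * a * z.re - a ^ 2) else 0

lemma measurable_truncTilt (a t : ℝ) : Measurable (truncTilt a t) := by
  unfold truncTilt
  exact Measurable.ite (measurableSet_le (by fun_prop) (by fun_prop)) (by fun_prop) (by fun_prop)

lemma truncTilt_nonneg (a t : ℝ) (z : ℂ) : 0 ≤ truncTilt a t z := by
  unfold truncTilt; split_ifs <;> positivity

lemma truncTilt_le_exp (a t : ℝ) (z : ℂ) : truncTilt a t z ≤ Real.exp (2 * a * z.re - a ^ 2) := by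
  unfold truncTilt; split_ifs <;> [exact le_rfl; positivity]

lemma truncTilt_le {a : ℝ} (ha : 0 ≤ a) (t : ℝ) (z : ℂ) :
    truncTilt a t z ≤ Real.exp (2 * a * t - a ^ 2) := by
  unfold truncTilt
  split_ifs with h
  · gcongr
  · positivity

lemma memLp_truncTilt {a : ℝ} (ha : 0 ≤ a) (t : ℝ) (p : ENNReal) :
    MemLp (truncTilt a t) p stdComplexNormal :=
  MemLp.of_bound (measurable_truncTilt a t).aestronglyMeasurable _ <| .of_forall fun z => by
    rw [Real.norm_of_nonneg (truncTilt_nonneg a t z)]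
    exact truncTilt_le ha t z

lemma integrable_truncTilt {a : ℝ} (ha : 0 ≤ a) (t : ℝ) :
    Integrable (truncTilt a t) stdComplexNormal :=
  (memLp_truncTilt ha t 1).integrable le_rfl

lemma integral_truncTilt_le_one {a : ℝ} (ha : 0 ≤ a) (t : ℝ) :
    ∫ z, truncTilt a t z ∂stdComplexNormal ≤ 1 := by
  calc ∫ z, truncTilt a t z ∂stdComplexNormal
      ≤ ∫ z : ℂ, Real.exp (2 * a * z.re + -a ^ 2) ∂stdComplexNormal :=
        integral_mono (integrable_truncTilt ha t) (integrable_exp_mul_re_add _ _)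
          fun z => truncTilt_le_exp a t z
    _ = 1 := by
      rw [integral_exp_mul_re_add, ← Real.exp_zero]
      congr 1
      ring

/-- The lost mass is the probability that the shifted variable exceeds `t`. Beyond `t`, replacing
the tilt `a` by `t` costs the factor `exp (2 (t - a) (z.re - t)) ≥ 1`, and the resulting Gaussian
integral is `exp (-(t - a)²)`. -/
lemma one_sub_exp_le_integral_truncTilt {a t : ℝ} (ha : 0 ≤ a) (hat : a ≤ t) :
    1 - Real.exp (-(t - a) ^ 2) ≤ ∫ z, truncTilt a t z ∂stdComplexNormal := by
  have h1 : ∫ z : ℂ, (Real.exp (2 * a * z.re + -a ^ 2) -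
      Real.exp (2 * t * z.re + (-a ^ 2 - 2 * (t - a) * t))) ∂stdComplexNormal =
      1 - Real.exp (-(t - a) ^ 2) := by
    rw [integral_sub (integrable_exp_mul_re_add _ _) (integrable_exp_mul_re_add _ _),
      integral_exp_mul_re_add, integral_exp_mul_re_add, ← Real.exp_zero]
    congr 2 <;> ring
  rw [← h1]
  refine integral_mono ((integrable_exp_mul_re_add _ _).sub (integrable_exp_mul_re_add _ _))
    (integrable_truncTilt ha t) fun z => ?_
  simp only [truncTilt]
  split_ifs with h
  · rw [sub_eq_add_neg (2 * a * z.re)]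
    linarith [Real.exp_pos (2 * t * z.re + (-a ^ 2 - 2 * (t - a) * t))]
  · rw [sub_nonpos, Real.exp_le_exp]
    nlinarith [mul_nonneg (sub_nonneg.2 hat) (sub_nonneg.2 (not_le.1 h).le)]

/-- Chernoff bound: on `z.re ≤ t` the factor `exp (l (t - z.re))` is at least 1, so it may be
inserted before the truncation is dropped. The parameter `l` is left free for later optimization. -/
lemma integral_truncTilt_sq_le {a t l : ℝ} (ha : 0 ≤ a) (hl : 0 ≤ l) :
    ∫ z, truncTilt a t z ^ 2 ∂stdComplexNormal ≤
      Real.exp (-2 * a ^ 2 + l * t + (4 * a - l) ^ 2 / 4) := by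
  calc ∫ z, truncTilt a t z ^ 2 ∂stdComplexNormal
      ≤ ∫ z : ℂ, Real.exp ((4 * a - l) * z.re + (-2 * a ^ 2 + l * t)) ∂stdComplexNormal := by
        refine integral_mono (memLp_truncTilt ha t 2).integrable_sq
          (integrable_exp_mul_re_add _ _) fun z => ?_
        simp only [truncTilt]
        split_ifs with h
        · rw [← Real.exp_nat_mul, Real.exp_le_exp]
          push_cast
          nlinarith [mul_nonneg hl (sub_nonneg.2 h)]
        · rw [zero_pow two_ne_zero]
          positivity
    _ = _ := by
      rw [integral_exp_mul_re_add]
      congr 1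
      ring

/-! ### Block averages and the mixture likelihood ratio -/

/-- The average of the truncated likelihood ratios over the cells of a block. -/
noncomputable def blockLik {m : ℕ} (a t : ℝ) (g : Fin m → ℂ) : ℝ :=
  (1 / (m : ℝ)) * ∑ i, truncTilt a t (g i)

lemma measurable_blockLik {m : ℕ} (a t : ℝ) : Measurable (blockLik (m := m) a t) := by
  unfold blockLik
  have := measurable_truncTilt a t
  fun_prop

lemma memLp_blockLik {m : ℕ} {a : ℝ} (ha : 0 ≤ a) (t : ℝ) (p : ENNReal) :
    MemLp (blockLik (m := m) a t) p (Measure.pi fun _ => stdComplexNormal) := by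
  have h : ∀ i, MemLp (fun g : Fin m → ℂ => truncTilt a t (g i)) p
      (Measure.pi fun _ => stdComplexNormal) := fun i =>
    (memLp_truncTilt ha t p).comp_measurePreserving
      (measurePreserving_eval (fun _ : Fin m => stdComplexNormal) i)
  exact (memLp_finsetSum Finset.univ fun i _ => h i).const_mul _

lemma integral_blockLik {m : ℕ} (hm : 0 < m) {a : ℝ} (ha : 0 ≤ a) (t : ℝ) :
    ∫ g, blockLik (m := m) a t g ∂(Measure.pi fun _ => stdComplexNormal) =
      ∫ z, truncTilt a t z ∂stdComplexNormal := by
  have hm' : (m : ℝ) ≠ 0 := by positivity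
  unfold blockLik
  rw [integral_const_mul, integral_finsetSum _ fun i _ =>
    integrable_comp_eval (integrable_truncTilt ha t)]
  simp_rw [integral_comp_eval (μ := fun _ : Fin m => stdComplexNormal)
    (measurable_truncTilt a t).aestronglyMeasurable]
  simp
  field_simp

/-- Averaging `m` independent cells divides the variance by `m`, while the squared mean is at most
1. -/
lemma integral_blockLik_sq_le {m : ℕ} (hm : 0 < m) {a : ℝ} (ha : 0 ≤ a) (t : ℝ) :
    ∫ g, blockLik (m := m) a t g ^ 2 ∂(Measure.pi fun _ => stdComplexNormal) ≤
      1 + (∫ z, truncTilt a t z ^ 2 ∂stdComplexNormal) / m := by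
  have hm' : (0 : ℝ) < m := by exact_mod_cast hm
  have h1 := variance_eq_sub (memLp_blockLik (m := m) ha t 2)
  have h2 : Var[blockLik (m := m) a t; Measure.pi fun _ => stdComplexNormal] =
      Var[truncTilt a t; stdComplexNormal] / m := by
    have h3 : blockLik (m := m) a t =
        fun g => (1 / (m : ℝ)) * (∑ i, fun g : Fin m → ℂ => truncTilt a t (g i)) g := by
      funext g; simp [blockLik]
    rw [h3, variance_const_mul, variance_sum_pi (X := fun _ => truncTilt a t)
      fun _ => memLp_truncTilt ha t 2]
    simp
    field_simp
  have h4 : Var[truncTilt a t; stdComplexNormal] ≤ ∫ z, truncTilt a t z ^ 2 ∂stdComplexNormal :=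
    variance_le_expectation_sq (measurable_truncTilt a t).aestronglyMeasurable
  have h5 := integral_blockLik hm ha t
  have h6 := integral_truncTilt_le_one ha t
  have h7 : 0 ≤ ∫ z, truncTilt a t z ∂stdComplexNormal :=
    integral_nonneg fun z => truncTilt_nonneg a t z
  simp only [Pi.pow_apply] at h1
  rw [h2, h5] at h1
  have h8 : Var[truncTilt a t; stdComplexNormal] / m ≤
      (∫ z, truncTilt a t z ^ 2 ∂stdComplexNormal) / m := by gcongr
  nlinarith

/-- The truncated likelihood ratio of the mixture over one position per block. -/
noncomputable def mixLik {s m : ℕ} (a t : ℝ) (g : Fin s → Fin m → ℂ) : ℝ :=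
  ∏ b, blockLik a t (g b)

/-- Expanding the product of sums exhibits the uniform prior over all choices of one cell per block.
-/
lemma mixLik_eq_sum {s m : ℕ} (a t : ℝ) (g : Fin s → Fin m → ℂ) :
    mixLik a t g = (1 / (m : ℝ)) ^ s *
      ∑ k : Fin s → Fin m, ∏ b, truncTilt a t (g b (k b)) := by
  simp only [mixLik, blockLik]
  rw [Finset.prod_mul_distrib, Finset.prod_univ_sum, Fintype.piFinset_univ]
  simp

lemma measurable_mixLik {s m : ℕ} (a t : ℝ) : Measurable (mixLik (s := s) (m := m) a t) := by
  unfold mixLik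
  have := measurable_blockLik (m := m) a t
  fun_prop

lemma integrable_mixLik {s m : ℕ} {a : ℝ} (ha : 0 ≤ a) (t : ℝ) :
    Integrable (mixLik (s := s) (m := m) a t) (blockNoise s m) :=
  Integrable.fintype_prod fun _ => (memLp_blockLik ha t 1).integrable le_rfl

lemma integrable_mixLik_sq {s m : ℕ} {a : ℝ} (ha : 0 ≤ a) (t : ℝ) :
    Integrable (fun g => mixLik (s := s) (m := m) a t g ^ 2) (blockNoise s m) := by
  simp only [mixLik, ← Finset.prod_pow]
  exact Integrable.fintype_prod (f := fun _ g => blockLik a t g ^ 2)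
    fun _ => (memLp_blockLik ha t 2).integrable_sq

/-- Expand the square. Blocks are independent, so both moments are powers: Bernoulli's inequality
bounds the mean below by `1 - s q`, and `(1 + B / m) ^ s ≤ exp (s B / m)` bounds the second moment.
-/
lemma integral_sq_one_sub_mixLik_le {s m : ℕ} (hm : 0 < m) {a t l : ℝ} (ha : 0 ≤ a) (hat : a ≤ t)
    (hl : 0 ≤ l) :
    ∫ g, (1 - mixLik (s := s) (m := m) a t g) ^ 2 ∂(blockNoise s m) ≤
      Real.exp (s * (Real.exp (-2 * a ^ 2 + l * t + (4 * a - l) ^ 2 / 4) / m)) +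
        2 * (s * Real.exp (-(t - a) ^ 2)) - 1 := by
  have hm' : (0 : ℝ) < m := by exact_mod_cast hm
  set q := Real.exp (-(t - a) ^ 2) with hq
  set B := Real.exp (-2 * a ^ 2 + l * t + (4 * a - l) ^ 2 / 4) with hB
  have hq1 : q ≤ 1 := Real.exp_le_one_iff.2 (by nlinarith [sq_nonneg (t - a)])
  have h1 : 1 - s * q ≤ ∫ g, mixLik (s := s) (m := m) a t g ∂(blockNoise s m) := by
    unfold mixLik blockNoise
    rw [integral_fintype_prod_eq_pow, integral_blockLik hm ha t, Fintype.card_fin]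
    have := one_sub_exp_le_integral_truncTilt ha hat
    calc 1 - s * q = 1 + s * (-q) := by ring
      _ ≤ (1 + -q) ^ s := one_add_mul_le_pow (by linarith) s
      _ ≤ _ := pow_le_pow_left₀ (by linarith) (by linarith) s
  have h2 : ∫ g, mixLik (s := s) (m := m) a t g ^ 2 ∂(blockNoise s m) ≤
      Real.exp (s * (B / m)) := by
    unfold mixLik blockNoise
    simp_rw [← Finset.prod_pow]
    rw [integral_fintype_prod_eq_pow (fun g => blockLik a t g ^ 2), Fintype.card_fin,
      Real.exp_nat_mul]
    refine pow_le_pow_left₀ (integral_nonneg fun g => by positivity)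
      ((integral_blockLik_sq_le hm ha t).trans ?_) s
    have h3 : (∫ z, truncTilt a t z ^ 2 ∂stdComplexNormal) / m ≤ B / m := by
      gcongr
      exact integral_truncTilt_sq_le ha hl
    linarith [Real.add_one_le_exp (B / m)]
  have h3 : ∀ g : Fin s → Fin m → ℂ, (1 - mixLik a t g) ^ 2 =
      1 - 2 * mixLik a t g + mixLik a t g ^ 2 := fun g => by ring
  have h4 : Integrable (fun g => 2 * mixLik (s := s) (m := m) a t g) (blockNoise s m) :=
    (integrable_mixLik ha t).const_mul 2
  have h5 : Integrable (fun g => 1 - 2 * mixLik (s := s) (m := m) a t g) (blockNoise s m) :=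
    (integrable_const _).sub h4
  simp_rw [h3]
  rw [integral_add h5 (integrable_mixLik_sq ha t), integral_sub (integrable_const _) h4,
    integral_const_mul]
  simp only [integral_const, probReal_univ, smul_eq_mul, mul_one]
  linarith

lemma integral_abs_one_sub_mixLik_le {s m : ℕ} (hm : 0 < m) {a t l : ℝ} (ha : 0 ≤ a) (hat : a ≤ t)
    (hl : 0 ≤ l) :
    ∫ g, |1 - mixLik (s := s) (m := m) a t g| ∂(blockNoise s m) ≤
      Real.sqrt (Real.exp (s * (Real.exp (-2 * a ^ 2 + l * t + (4 * a - l) ^ 2 / 4) / m)) +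
        2 * (s * Real.exp (-(t - a) ^ 2)) - 1) := by
  refine Real.le_sqrt_of_sq_le ((?_ : _ ≤ _).trans (integral_sq_one_sub_mixLik_le hm ha hat hl))
  have hL2 : MemLp (fun g => |1 - mixLik (s := s) (m := m) a t g|) 2 (blockNoise s m) := by
    have hmeas : Measurable fun g => |1 - mixLik (s := s) (m := m) a t g| := by
      have := measurable_mixLik (s := s) (m := m) a t
      fun_prop
    rw [memLp_two_iff_integrable_sq hmeas.aestronglyMeasurable]
    simp_rw [sq_abs]
    have h3 : ∀ g : Fin s → Fin m → ℂ, (1 - mixLik a t g) ^ 2 =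
      1 - 2 * mixLik a t g + mixLik a t g ^ 2 := fun g => by ring
    simp_rw [h3]
    exact ((integrable_const _).sub ((integrable_mixLik ha t).const_mul 2)).add
      (integrable_mixLik_sq ha t)
  have h1 := variance_eq_sub hL2
  have h2 := variance_nonneg (fun g => |1 - mixLik (s := s) (m := m) a t g|) (blockNoise s m)
  simp only [Pi.pow_apply, sq_abs] at h1
  linarith

/-! ### Reduction to the sequence model and the Bayes risk -/

/-- One coordinate of size `a` per block, at the cell chosen by `k`. -/
noncomputable def blockShift {s m : ℕ} (a : ℝ) (k : Fin s → Fin m) (b : Fin s) (i : Fin m) : ℝ :=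
  if i = k b then a else 0

/-- The likelihood ratio of the shift by `blockShift a k`. -/
noncomputable def shiftLik {s m : ℕ} (a : ℝ) (k : Fin s → Fin m) (g : Fin s → Fin m → ℂ) : ℝ :=
  ∏ b, Real.exp (2 * a * (g b (k b)).re - a ^ 2)

lemma measurable_shiftLik {s m : ℕ} (a : ℝ) (k : Fin s → Fin m) : Measurable (shiftLik a k) := by
  unfold shiftLik; fun_prop

lemma shiftLik_nonneg {s m : ℕ} (a : ℝ) (k : Fin s → Fin m) (g : Fin s → Fin m → ℂ) :
    0 ≤ shiftLik a k g := Finset.prod_nonneg fun _ _ => (Real.exp_pos _).le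

lemma blockNoise_map_blockShift {s m : ℕ} (a : ℝ) (k : Fin s → Fin m) :
    (blockNoise s m).map (fun g b i => (blockShift a k b i : ℂ) + g b i) =
      (blockNoise s m).withDensity (fun g => ENNReal.ofReal (shiftLik a k g)) := by
  rw [blockNoise_map_const_add]
  congr 1
  funext g
  rw [shiftLik, ← Real.exp_sum]
  congr 2
  refine Finset.sum_congr rfl fun b _ => ?_
  rw [Finset.sum_eq_single (k b)]
  · simp [blockShift]
  · intro i _ hi
    simp [blockShift, hi]
  · simp

lemma integrable_shiftLik {s m : ℕ} (a : ℝ) (k : Fin s → Fin m) :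
    Integrable (shiftLik a k) (blockNoise s m) := by
  have : IsProbabilityMeasure ((blockNoise s m).map
      (fun g b i => (blockShift a k b i : ℂ) + g b i)) :=
    Measure.isProbabilityMeasure_map
      (by fun_prop : Measurable fun (g : Fin s → Fin m → ℂ) b i =>
        (blockShift a k b i : ℂ) + g b i).aemeasurable
  have h1 : ∫⁻ g, ENNReal.ofReal (shiftLik a k g) ∂(blockNoise s m) = 1 := by
    rw [← setLIntegral_univ, ← withDensity_apply _ MeasurableSet.univ, ← blockNoise_map_blockShift]
    exact measure_univ
  exact (lintegral_ofReal_ne_top_iff_integrable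
    (measurable_shiftLik a k).aestronglyMeasurable
    (.of_forall fun g => shiftLik_nonneg a k g)).1 (by rw [h1]; exact ENNReal.one_ne_top)

lemma obsLaw_zero (N p : ℕ) : obsLaw N p 0 = noiseLaw N := by
  unfold obsLaw
  simp

/-- The observation as a function of the signal-bearing and the complementary noise. -/
noncomputable def mixNoise {N s m : ℕ} (C : Matrix (Fin N) (Fin s × Fin m) ℂ)
    (R : Matrix (Fin N) (Fin N) ℂ) (x : (Fin s → Fin m → ℂ) × (Fin N → ℂ)) : Fin N → ℂ :=
  C *ᵥ Function.uncurry x.1 + R *ᵥ x.2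

lemma measurable_mixNoise {N s m : ℕ} (C : Matrix (Fin N) (Fin s × Fin m) ℂ)
    (R : Matrix (Fin N) (Fin N) ℂ) : Measurable (mixNoise C R) := by
  refine Continuous.measurable (Continuous.add (continuous_const.matrix_mulVec ?_)
      (continuous_const.matrix_mulVec continuous_snd))
  refine continuous_pi fun q => ?_
  simp only [Function.uncurry]
  fun_prop

/-- Shifting the input `g` of `C g + R g'` by the block shift adds exactly the signal, so the
alternative is the image of a change of density in the signal coordinates only. -/
lemma obsLaw_eq_map_withDensity {N p s m : ℕ} {C : Matrix (Fin N) (Fin s × Fin m) ℂ}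
    {R : Matrix (Fin N) (Fin N) ℂ} (hCR : C * Cᴴ + R * Rᴴ = 1) {a : ℝ} {k : Fin s → Fin m}
    {β : Fin p → ℂ}
    (hβ : designMatrix N p *ᵥ β = C *ᵥ fun q => (blockShift a k q.1 q.2 : ℂ)) :
    obsLaw N p β = (((blockNoise s m).prod (noiseLaw N)).withDensity
      (fun x => ENNReal.ofReal (shiftLik a k x.1))).map (mixNoise C R) := by
  have hm := measurable_mixNoise C R
  have hadd : Measurable fun (g : Fin s → Fin m → ℂ) b i => (blockShift a k b i : ℂ) + g b i := by
    fun_prop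
  have : SigmaFinite ((blockNoise s m).withDensity
      (fun g => ENNReal.ofReal (shiftLik a k g))) := by
    rw [← blockNoise_map_blockShift]
    have := Measure.isProbabilityMeasure_map (μ := blockNoise s m) hadd.aemeasurable
    infer_instance
  have hnoise : noiseLaw N = ((blockNoise s m).prod (noiseLaw N)).map (mixNoise C R) :=
    (map_blockNoise_prod_noiseLaw hCR).symm
  have hprod : ((blockNoise s m).prod (noiseLaw N)).withDensity
      (fun x => ENNReal.ofReal (shiftLik a k x.1)) = ((blockNoise s m).prod (noiseLaw N)).map
        (Prod.map (fun g b i => (blockShift a k b i : ℂ) + g b i) id) := by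
    rw [← prod_withDensity_left (measurable_shiftLik a k).ennreal_ofReal,
      ← blockNoise_map_blockShift, ← Measure.map_prod_map _ _ hadd measurable_id, Measure.map_id]
  rw [hprod, Measure.map_map hm (hadd.prodMap measurable_id)]
  unfold obsLaw
  conv_lhs => rw [hnoise]
  rw [Measure.map_map (by fun_prop) hm]
  congr 1
  funext x
  simp only [Function.comp_apply, mixNoise, hβ, Prod.map_fst, Prod.map_snd, id]
  rw [← add_assoc, ← Matrix.mulVec_add]
  rfl

/-- The lower bound for the Bayes risk of a test, through the truncated second moment of the
likelihood ratio. -/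
theorem one_sub_sqrt_le_typeIError_add {N p s m : ℕ} (hm : 0 < m)
    {C : Matrix (Fin N) (Fin s × Fin m) ℂ}
    {R : Matrix (Fin N) (Fin N) ℂ} (hCR : C * Cᴴ + R * Rᴴ = 1) {a t l : ℝ} (ha : 0 ≤ a)
    (hat : a ≤ t) (hl : 0 ≤ l) (φ : Test N) (β : (Fin s → Fin m) → Fin p → ℂ)
    (hβ : ∀ k, designMatrix N p *ᵥ β k = C *ᵥ fun q => (blockShift a k q.1 q.2 : ℂ))
    {V : ℝ} (hV : ∀ k, ∫ y, (1 - φ.reject y) ∂(obsLaw N p (β k)) ≤ V) :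
    1 - Real.sqrt (Real.exp (s * (Real.exp (-2 * a ^ 2 + l * t + (4 * a - l) ^ 2 / 4) / m)) +
        2 * (s * Real.exp (-(t - a) ^ 2)) - 1) ≤ typeIError p φ + V := by
  have hm' : (0 : ℝ) < m := by exact_mod_cast hm
  set μ := (blockNoise s m).prod (noiseLaw N) with hμ
  have hT := measurable_mixNoise C R
  set f : (Fin s → Fin m → ℂ) × (Fin N → ℂ) → ℝ := fun x => φ.reject (mixNoise C R x) with hf
  have hfm : Measurable f := φ.measurable_reject.comp hT
  have hf0 : ∀ x, 0 ≤ f x := fun x => (φ.reject_mem _).1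
  have hf1 : ∀ x, 0 ≤ 1 - f x := fun x => sub_nonneg.2 (φ.reject_mem _).2
  have hfb : ∀ x, ‖1 - f x‖ ≤ 1 := fun x => by
    rw [Real.norm_of_nonneg (hf1 x)]; linarith [hf0 x]
  have hf1m : Measurable fun x => 1 - f x := measurable_const.sub hfm
  have hfi : Integrable f μ := Integrable.of_bound hfm.aestronglyMeasurable 1
    (.of_forall fun x => by rw [Real.norm_of_nonneg (hf0 x)]; linarith [hf1 x])
  have hI : typeIError p φ = ∫ x, f x ∂μ := by
    unfold typeIError
    rw [obsLaw_zero, ← map_blockNoise_prod_noiseLaw (s := s) (m := m) hCR]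
    exact integral_map hT.aemeasurable φ.measurable_reject.aestronglyMeasurable
  have hII : ∀ k, ∫ x, (1 - f x) * shiftLik a k x.1 ∂μ ≤ V := fun k => by
    refine le_of_eq_of_le ?_ (hV k)
    have hρ : Measurable fun x : (Fin s → Fin m → ℂ) × (Fin N → ℂ) =>
        ENNReal.ofReal (shiftLik a k x.1) :=
      ((measurable_shiftLik a k).comp measurable_fst).ennreal_ofReal
    have hrej : Measurable fun y => 1 - φ.reject y := measurable_const.sub φ.measurable_reject
    rw [obsLaw_eq_map_withDensity hCR (hβ k), integral_map hT.aemeasurable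
      hrej.aestronglyMeasurable,
      integral_withDensity_eq_integral_toReal_smul hρ
        (.of_forall fun _ => ENNReal.ofReal_lt_top)]
    refine integral_congr_ae (.of_forall fun x => ?_)
    simp only [ENNReal.toReal_ofReal (shiftLik_nonneg a k x.1), smul_eq_mul, hf]
    ring
  have hint : ∀ k, Integrable (fun x => (1 - f x) * shiftLik a k x.1) μ := fun k =>
    ((integrable_shiftLik a k).comp_fst (noiseLaw N)).bdd_mul hf1m.aestronglyMeasurable
      (.of_forall hfb)
  have hLi : Integrable (fun x => mixLik a t x.1) μ := (integrable_mixLik ha t).comp_fst (noiseLaw N)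
  have hLfi : Integrable (fun x => (1 - f x) * mixLik a t x.1) μ :=
    hLi.bdd_mul hf1m.aestronglyMeasurable (.of_forall hfb)
  have hmix : ∫ x, (1 - f x) * mixLik a t x.1 ∂μ ≤ V := by
    -- Truncation only lowers the likelihood ratio and `1 - f ≥ 0`, so the truncated mixture still
    -- bounds the averaged type II error from below.
    have h1 : ∀ x, (1 - f x) * mixLik a t x.1 ≤
        (1 / (m : ℝ)) ^ s * ∑ k : Fin s → Fin m, (1 - f x) * shiftLik a k x.1 := fun x => by
      rw [mixLik_eq_sum, ← Finset.mul_sum, mul_left_comm]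
      refine mul_le_mul_of_nonneg_left (mul_le_mul_of_nonneg_left
        (Finset.sum_le_sum fun k _ => ?_) (hf1 x)) (by positivity)
      exact Finset.prod_le_prod (fun b _ => truncTilt_nonneg _ _ _)
        fun b _ => truncTilt_le_exp _ _ _
    calc ∫ x, (1 - f x) * mixLik a t x.1 ∂μ
        ≤ ∫ x, (1 / (m : ℝ)) ^ s * ∑ k : Fin s → Fin m, (1 - f x) * shiftLik a k x.1 ∂μ :=
          integral_mono hLfi ((integrable_finsetSum _ fun k _ => hint k).const_mul _) h1
      _ = (1 / (m : ℝ)) ^ s * ∑ k : Fin s → Fin m, ∫ x, (1 - f x) * shiftLik a k x.1 ∂μ := by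
          rw [integral_const_mul, integral_finsetSum _ fun k _ => hint k]
      _ ≤ (1 / (m : ℝ)) ^ s * ∑ _k : Fin s → Fin m, V := by
          gcongr with k
          exact hII k
      _ = V := by
          rw [Finset.sum_const, Finset.card_univ, Fintype.card_fun, Fintype.card_fin,
            Fintype.card_fin, nsmul_eq_mul, Nat.cast_pow, ← mul_assoc, ← mul_pow,
            one_div_mul_cancel hm'.ne', one_pow, one_mul]
  have habs : ∫ x, |1 - mixLik a t x.1| ∂μ = ∫ g, |1 - mixLik a t g| ∂(blockNoise s m) := by
    rw [hμ, integral_fun_fst (μ := blockNoise s m) (ν := noiseLaw N)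
      (fun g => |1 - mixLik a t g|), probReal_univ, one_smul]
  have hle := integral_abs_one_sub_mixLik_le (s := s) (l := l) hm ha hat hl
  have hai : Integrable (fun x => |1 - mixLik a t x.1|) μ := ((integrable_const 1).sub hLi).abs
  have hlow : 1 - ∫ x, |1 - mixLik a t x.1| ∂μ ≤
      ∫ x, f x ∂μ + ∫ x, (1 - f x) * mixLik a t x.1 ∂μ := by
    rw [← integral_add hfi hLfi]
    have h1 : (1 : ℝ) - ∫ x, |1 - mixLik a t x.1| ∂μ = ∫ x, (1 - |1 - mixLik a t x.1|) ∂μ := by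
      rw [integral_sub (integrable_const 1) hai]
      simp
    rw [h1]
    refine integral_mono ((integrable_const 1).sub hai) (hfi.add hLfi) fun x => ?_
    -- This is the pointwise form of the bound, because `f + (1 - f) L = 1 - (1 - f) (1 - L)`.
    have h2 : (1 - f x) * (1 - mixLik a t x.1) ≤ 1 * |1 - mixLik a t x.1| :=
      (mul_le_mul_of_nonneg_left (le_abs_self _) (hf1 x)).trans
        (mul_le_mul_of_nonneg_right (by linarith [hf0 x]) (abs_nonneg _))
    simp only
    nlinarith
  rw [hI]
  linarith

/-! ### Elementary bounds for errors and risk -/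

instance isProbabilityMeasure_obsLaw (N p : ℕ) (β : Fin p → ℂ) :
    IsProbabilityMeasure (obsLaw N p β) :=
  Measure.isProbabilityMeasure_map (by fun_prop)

lemma integral_accept_mem_Icc {N p : ℕ} (φ : Test N) (β : Fin p → ℂ) :
    ∫ y, (1 - φ.reject y) ∂(obsLaw N p β) ∈ Set.Icc (0 : ℝ) 1 := by
  refine ⟨integral_nonneg fun y => sub_nonneg.2 (φ.reject_mem y).2, ?_⟩
  have hm : Measurable fun y => 1 - φ.reject y := measurable_const.sub φ.measurable_reject
  have h : ∫ y, (1 - φ.reject y) ∂(obsLaw N p β) ≤ ∫ _, (1 : ℝ) ∂(obsLaw N p β) := by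
    refine integral_mono (Integrable.of_bound hm.aestronglyMeasurable 1
      (.of_forall fun y => ?_)) (integrable_const 1) fun y => ?_
    · rw [Real.norm_of_nonneg (sub_nonneg.2 (φ.reject_mem y).2)]
      linarith [(φ.reject_mem y).1]
    · simp only
      linarith [(φ.reject_mem y).1]
  simpa using h

lemma typeIError_mem_Icc {N p : ℕ} (φ : Test N) : typeIError p φ ∈ Set.Icc (0 : ℝ) 1 := by
  refine ⟨integral_nonneg fun y => (φ.reject_mem y).1, ?_⟩
  have h : typeIError p φ ≤ ∫ _, (1 : ℝ) ∂(obsLaw N p 0) := by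
    refine integral_mono (Integrable.of_bound φ.measurable_reject.aestronglyMeasurable 1
      (.of_forall fun y => ?_)) (integrable_const 1) fun y => (φ.reject_mem y).2
    rw [Real.norm_of_nonneg (φ.reject_mem y).1]
    exact (φ.reject_mem y).2
  simpa using h

/-- An empty parameter space causes no exception: the real supremum over it is 0 by default. -/
lemma typeIIError_mem_Icc {N : ℕ} (p s : ℕ) (r : ℝ) (φ : Test N) :
    typeIIError p s r φ ∈ Set.Icc (0 : ℝ) 1 :=
  ⟨Real.iSup_nonneg fun _ => (integral_accept_mem_Icc φ _).1,
    Real.iSup_le (fun _ => (integral_accept_mem_Icc φ _).2) zero_le_one⟩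

lemma le_typeIIError {N p s : ℕ} {r : ℝ} (φ : Test N) {τ : Fin s → Fin p} {b : Fin s → ℂ}
    (h : (τ, b) ∈ paramSpace p N s r) :
    ∫ y, (1 - φ.reject y) ∂(obsLaw N p (signal τ b)) ≤ typeIIError p s r φ :=
  le_ciSup (f := fun x : paramSpace p N s r =>
      ∫ y, (1 - φ.reject y) ∂(obsLaw N p (signal x.1.1 x.1.2)))
    ⟨1, by rintro _ ⟨x, rfl⟩; exact (integral_accept_mem_Icc φ _).2⟩ ⟨(τ, b), h⟩

/-- The test that never rejects. -/
def acceptTest (N : ℕ) : Test N where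
  reject := fun _ => 0
  measurable_reject := measurable_const
  reject_mem := fun _ => ⟨le_rfl, zero_le_one⟩

lemma risk_acceptTest_le (N p s : ℕ) (r : ℝ) : risk p s r (acceptTest N) ≤ 1 := by
  have h1 : typeIError p (acceptTest N) = 0 := by simp [typeIError, acceptTest]
  rw [risk, h1, zero_add]
  exact (typeIIError_mem_Icc p s r _).2

lemma risk_nonneg {N : ℕ} (p s : ℕ) (r : ℝ) (φ : Test N) : 0 ≤ risk p s r φ :=
  add_nonneg (typeIError_mem_Icc φ).1 (typeIIError_mem_Icc p s r φ).1

lemma risk_le_two {N : ℕ} (p s : ℕ) (r : ℝ) (φ : Test N) : risk p s r φ ≤ 2 := by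
  have h1 := (typeIError_mem_Icc (p := p) φ).2
  have h2 := (typeIIError_mem_Icc p s r φ).2
  unfold risk
  linarith

/-! ### Grid supports and the non-asymptotic bound -/

/-- The support that takes cell `k b` in block `b`. -/
def gridSupport {p s m D : ℕ} (hD : 0 < D) (h : s * m * D ≤ p) (k : Fin s → Fin m) (b : Fin s) :
    Fin p := ⟨gridPos D (b, k b), gridPos_lt hD h (b, k b)⟩

/-- Distinct blocks use distinct cells, but these may be adjacent across a block boundary; only one
mesh width is guaranteed. -/
lemma gridPos_add_le {s m : ℕ} (D : ℕ) (k : Fin s → Fin m) {b b' : Fin s} (h : b < b') :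
    gridPos D (b, k b) + D ≤ gridPos D (b', k b') := by
  have h1 : (b : ℕ) + 1 ≤ b' := h
  have h2 := (k b).isLt
  have h3 : m * ((b : ℕ) + 1) ≤ m * b' := Nat.mul_le_mul_left m h1
  unfold gridPos
  calc D * ((k b : ℕ) + m * b) + D = D * ((k b : ℕ) + 1 + m * b) := by ring
    _ ≤ D * ((k b' : ℕ) + m * b') := Nat.mul_le_mul_left D (by rw [mul_add] at h3; omega)

lemma gridSupport_strictMono {p s m D : ℕ} (hD : 0 < D) (h : s * m * D ≤ p) (k : Fin s → Fin m) :
    StrictMono (gridSupport hD h k) := fun b b' hb => by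
  have := gridPos_add_le D k hb
  exact Fin.lt_def.2 (by simp only [gridSupport]; omega)

lemma div_le_minSeparation_gridSupport {p s m D : ℕ} (hs : 0 < s) (hD : 0 < D)
    (h : s * m * D ≤ p) (k : Fin s → Fin m) :
    (D : ℝ) / p ≤ minSeparation (gridSupport hD h k) := by
  have : Nonempty (Fin s) := ⟨⟨0, hs⟩⟩
  unfold minSeparation
  rw [div_eq_mul_one_div, mul_comm]
  refine mul_le_mul_of_nonneg_left (le_ciInf fun b => ?_) (by positivity)
  have key : gridPos D (b, k b) + D ≤ nextIndex (gridSupport hD h k) b := by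
    unfold nextIndex
    split_ifs with hb
    · exact gridPos_add_le D k (Fin.lt_def.2 (Nat.lt_succ_self _))
    -- For the cyclic gap after the last spike: every cell, counted with its full width `D`, ends no
    -- later than `p`, and the next index is at least `p`.
    · have h1 : (k b : ℕ) + m * (b : ℕ) + 1 ≤ s * m := (finProdFinEquiv (b, k b)).isLt
      have h2 : gridPos D (b, k b) + D ≤ p := by
        calc gridPos D (b, k b) + D = D * ((k b : ℕ) + m * (b : ℕ) + 1) := by
              unfold gridPos; ring
          _ ≤ D * (s * m) := Nat.mul_le_mul_left D h1
          _ ≤ p := by rw [mul_comm]; exact h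
      omega
  have key' : (gridPos D (b, k b) : ℝ) + D ≤ nextIndex (gridSupport hD h k) b := by
    exact_mod_cast key
  refine le_trans ?_ (le_abs_self _)
  exact le_sub_iff_add_le'.2 key'

/-- The factor `√c` removed from the columns reappears in the spike height. -/
lemma designMatrix_mulVec_gridSignal {N p s m D : ℕ} (hD : 0 < D) (h : s * m * D ≤ p)
    (k : Fin s → Fin m) {c : ℝ} (hc : 0 < c) (A : ℝ) :
    designMatrix N p *ᵥ signal (gridSupport hD h k) (fun _ => (A : ℂ)) =
      gridMatrix N p s m D c *ᵥ fun q => (blockShift (Real.sqrt c * A) k q.1 q.2 : ℂ) := by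
  have hc' : (Real.sqrt c : ℂ) ≠ 0 := by exact_mod_cast (Real.sqrt_pos.2 hc).ne'
  funext j
  simp only [Matrix.mulVec, dotProduct, signal, Finset.mul_sum]
  rw [Finset.sum_comm, Fintype.sum_prod_type]
  refine Finset.sum_congr rfl fun b _ => ?_
  rw [Finset.sum_eq_single (gridSupport hD h k b), Finset.sum_eq_single (k b)]
  · simp only [blockShift, if_true, designMatrix, gridMatrix, Matrix.of_apply, gridSupport]
    push_cast
    field_simp
  · intro i _ hi
    simp [blockShift, hi]
  · simp
  · intro i _ hi
    simp [hi.symm]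
  · simp

/-- A non-asymptotic lower bound for the risk of every test. -/
theorem one_sub_sqrt_le_risk {N p s m D : ℕ} {r η t l : ℝ} (hη : 0 ≤ η) (hN : 0 < N)
    (hp : 0 < p) (hs : 0 < s) (hm : 0 < m) (hD : 0 < D) (hsm : 2 * (s * m * D) ≤ p)
    (hgram : (p : ℝ) / D * (1 + Real.log ((s * m : ℕ) : ℝ)) ≤ η * N)
    (hsep : Real.log (N : ℝ) ^ 2 / (N : ℝ) ≤ (D : ℝ) / p)
    (hat : Real.sqrt (r * (1 + η) * Real.log p) ≤ t) (hl : 0 ≤ l) (φ : Test N) :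
    1 - Real.sqrt (Real.exp (s * (Real.exp (-2 * Real.sqrt (r * (1 + η) * Real.log p) ^ 2 + l * t +
      (4 * Real.sqrt (r * (1 + η) * Real.log p) - l) ^ 2 / 4) / m)) +
        2 * (s * Real.exp (-(t - Real.sqrt (r * (1 + η) * Real.log p)) ^ 2)) - 1) ≤
      risk p s r φ := by
  have hN' : (0 : ℝ) < N := by exact_mod_cast hN
  have hp' : (0 : ℝ) < p := by exact_mod_cast hp
  have hlog : 0 ≤ Real.log p := Real.log_natCast_nonneg p
  have hc : 0 < (N : ℝ) / p * (1 + η) := by positivity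
  have hsm' : s * m * D ≤ p := by omega
  obtain ⟨R, hR⟩ := exists_mul_conjTranspose_add_eq_one _
    (gridMatrix_schur (N := N) hη hN hD hp hsm hgram)
  -- The normalization of the amplitude cancels `N / p`; making the columns a contraction costs only
  -- the factor `1 + η` in signal strength.
  have ha : Real.sqrt (r * (1 + η) * Real.log p) =
      Real.sqrt ((N : ℝ) / p * (1 + η)) * Real.sqrt (r * p * Real.log p / N) := by
    rw [← Real.sqrt_mul hc.le]
    congr 1
    field_simp
  refine one_sub_sqrt_le_typeIError_add hm hR (Real.sqrt_nonneg _) hat hl φ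
    (fun k => signal (gridSupport hD hsm' k)
      fun _ => ((Real.sqrt (r * p * Real.log p / N) : ℝ) : ℂ))
    (fun k => by rw [ha]; exact designMatrix_mulVec_gridSignal hD hsm' k hc _)
    fun k => le_typeIIError φ ⟨gridSupport_strictMono hD hsm' k, fun b => ?_,
      hsep.trans (div_le_minSeparation_gridSupport hs hD hsm' k)⟩
  rw [Complex.norm_real, Real.norm_of_nonneg (Real.sqrt_nonneg _)]

/-! ### Exponents at the detection boundary -/

/-- The exponent of the truncated second moment is negative below the detection boundary, for a
suitable Chernoff parameter `c`. Here `u ^ 2 = 1 - γ`, `v ^ 2 = 1 - α`, and `w ^ 2` is the signal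
strength. -/
lemma exists_chernoff_exponent_neg {u v w : ℝ} (h : w + v < u)
    (hdense : 2 * w ≤ u → 2 * w ^ 2 < u ^ 2 - 2 * v ^ 2) (hv : 0 ≤ v) :
    ∃ c, 0 ≤ c ∧ 2 * v ^ 2 - u ^ 2 + (-2 * w ^ 2 + c * u + (4 * w - c) ^ 2 / 4) < 0 := by
  -- The quadratic in `c` is minimized at `2 (2w - u)`. When this is not positive the constraint `0
  -- ≤ c` gives `c = 0`, meaning the plain second moment; otherwise the value at the minimum is `2v²
  -- - 2(u - w)²`.
  rcases le_or_gt (2 * w) u with h2 | h2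
  · exact ⟨0, le_rfl, by nlinarith [hdense h2]⟩
  · exact ⟨2 * (2 * w - u), by linarith, by nlinarith⟩

lemma lt_rhoStar_imp {γ α ρ : ℝ} (hα₀ : (1 + γ) / 2 < α) (hα₁ : α < 1)
    (hρ₀ : 0 ≤ ρ) (hρ : ρ < rhoStar γ α) :
    Real.sqrt ρ + Real.sqrt (1 - α) < Real.sqrt (1 - γ) ∧
      (2 * Real.sqrt ρ ≤ Real.sqrt (1 - γ) →
        2 * Real.sqrt ρ ^ 2 < Real.sqrt (1 - γ) ^ 2 - 2 * Real.sqrt (1 - α) ^ 2) := by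
  have hu2 := Real.sq_sqrt (by linarith : 0 ≤ 1 - γ)
  have hv2 := Real.sq_sqrt (by linarith : 0 ≤ 1 - α)
  have hw2 := Real.sq_sqrt hρ₀
  have hvu : Real.sqrt (1 - α) < Real.sqrt (1 - γ) :=
    Real.sqrt_lt_sqrt (by linarith) (by linarith)
  have hu := Real.sqrt_nonneg (1 - γ)
  have hv := Real.sqrt_nonneg (1 - α)
  have hw := Real.sqrt_nonneg ρ
  unfold rhoStar at hρ
  set u := Real.sqrt (1 - γ)
  set v := Real.sqrt (1 - α)
  set w := Real.sqrt ρ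
  split_ifs at hρ with hα
  · have h1 : w < u - v := lt_of_pow_lt_pow_left₀ 2 (by linarith) (by rw [hw2]; exact hρ)
    -- On the sparse branch `4v² ≤ u²`, so `2w ≤ u` yields `2w² ≤ u² / 2 ≤ u² - 2v²`; strictness
    -- comes from `w < u - v` if `2v = u`.
    have h2 : 2 * v ≤ u := by
      refine le_of_sq_le_sq ?_ hu
      nlinarith
    exact ⟨by linarith, fun h => by nlinarith⟩
  · have h1 : w < u - v := by
      refine lt_of_pow_lt_pow_left₀ 2 (by linarith) ?_
      -- The dense boundary `u² / 2 - v²` lies below `(u - v)²` by exactly `(2v - u)² / 2`.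
      nlinarith [sq_nonneg (2 * v - u)]
    exact ⟨by linarith, fun h => by nlinarith⟩

/-! ### Choice of the grid and asymptotics -/

lemma half_le_natFloor {y : ℝ} (hy : 1 ≤ y) : y / 2 ≤ ⌊y⌋₊ := by
  have h1 := Nat.lt_floor_add_one y
  have h2 : (1 : ℝ) ≤ ⌊y⌋₊ := by exact_mod_cast Nat.floor_pos.2 hy
  linarith

/-- Only `N` is assumed to diverge; `p` follows because `N - 1 < p ^ (1 - γ) ≤ p`. -/
lemma tendsto_of_abs_sub_rpow_lt_one {γ : ℝ} (hγ₀ : 0 ≤ γ) (hγ₁ : γ < 1) {p N : ℕ → ℕ}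
    (hN : Tendsto N atTop atTop) (hNp : ∀ n, |(N n : ℝ) - (p n : ℝ) ^ (1 - γ)| < 1) :
    Tendsto (fun n => (p n : ℝ)) atTop atTop := by
  have h1 : Tendsto (fun n => (N n : ℝ) - 1) atTop atTop :=
    tendsto_atTop_add_const_right _ _ (tendsto_natCast_atTop_atTop.comp hN)
  refine tendsto_atTop_mono (fun n => ?_) h1
  have h2 := (abs_lt.1 (hNp n)).2
  have h3 : (p n : ℝ) ^ (1 - γ) ≤ p n := by
    rcases Nat.eq_zero_or_pos (p n) with h | h
    · rw [h, Nat.cast_zero, Real.zero_rpow (by linarith)]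
    · exact Real.rpow_le_self_of_one_le (by exact_mod_cast h) (by linarith)
  linarith

/-- The quantitative size requirements on the grid, for large `p`. -/
lemma grid_requirements {γ α η ε y : ℝ} {p N s : ℕ} (hγ₀ : 0 ≤ γ)
    (hη : 0 < η) (hε : 0 < ε) (hεα : ε < α - γ) (hp : (2 : ℝ) ≤ p)
    (hNp : |(N : ℝ) - (p : ℝ) ^ (1 - γ)| < 1) (hsp : |(s : ℝ) - (p : ℝ) ^ (1 - α)| < 1)
    (hpN : 2 ≤ (p : ℝ) ^ (1 - γ)) (hps : 2 ≤ (p : ℝ) ^ (1 - α))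
    (hy : y = (p : ℝ) ^ (ε / 4)) (hlog : Real.log p ≤ y / 4) (hy4 : 4 ≤ y) (hyη : 8 / η ≤ y) :
    0 < N ∧ 0 < s ∧ (s : ℝ) ≤ 2 * (p : ℝ) ^ (1 - α) ∧
    0 < ⌊(p : ℝ) ^ (α - γ - ε)⌋₊ ∧
    (p : ℝ) ^ (α - γ - ε) / 2 ≤ ⌊(p : ℝ) ^ (α - γ - ε)⌋₊ ∧
    0 < ⌊(p : ℝ) ^ (γ + ε / 2)⌋₊ ∧
    2 * (s * ⌊(p : ℝ) ^ (α - γ - ε)⌋₊ * ⌊(p : ℝ) ^ (γ + ε / 2)⌋₊) ≤ p ∧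
    (p : ℝ) / ⌊(p : ℝ) ^ (γ + ε / 2)⌋₊ *
      (1 + Real.log ((s * ⌊(p : ℝ) ^ (α - γ - ε)⌋₊ : ℕ) : ℝ)) ≤ η * N ∧
    Real.log (N : ℝ) ^ 2 / (N : ℝ) ≤ (⌊(p : ℝ) ^ (γ + ε / 2)⌋₊ : ℝ) / p := by
  have hp0 : (0 : ℝ) < p := by linarith
  have hNlo : (p : ℝ) ^ (1 - γ) / 2 ≤ N := by linarith [(abs_lt.1 hNp).1]
  have hNhi : (N : ℝ) ≤ 2 * (p : ℝ) ^ (1 - γ) := by linarith [(abs_lt.1 hNp).2]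
  have hslo : (p : ℝ) ^ (1 - α) / 2 ≤ s := by linarith [(abs_lt.1 hsp).1]
  have hshi : (s : ℝ) ≤ 2 * (p : ℝ) ^ (1 - α) := by linarith [(abs_lt.1 hsp).2]
  have hN0 : (1 : ℝ) ≤ N := by linarith
  have hs0 : (1 : ℝ) ≤ s := by linarith
  have hM1 : 1 ≤ (p : ℝ) ^ (α - γ - ε) := Real.one_le_rpow (by linarith) (by linarith)
  have hD1 : 1 ≤ (p : ℝ) ^ (γ + ε / 2) := Real.one_le_rpow (by linarith) (by linarith)
  have hMhi := Nat.floor_le (zero_le_one.trans hM1)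
  have hDhi := Nat.floor_le (zero_le_one.trans hD1)
  have hMlo := half_le_natFloor hM1
  have hDlo := half_le_natFloor hD1
  have hMpos := Nat.floor_pos.2 hM1
  have hDpos := Nat.floor_pos.2 hD1
  generalize ⌊(p : ℝ) ^ (α - γ - ε)⌋₊ = m at *
  generalize ⌊(p : ℝ) ^ (γ + ε / 2)⌋₊ = D at *
  have hy2 : y ^ 2 = (p : ℝ) ^ (ε / 2) := by
    rw [hy, ← Real.rpow_natCast, ← Real.rpow_mul hp0.le]
    congr 1
    push_cast
    ring
  -- The mesh exceeds the resolution `p / N ≈ p ^ γ` by the factor `y²`, which absorbs the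
  -- logarithms and `1 / η`. The same factor is left over in `hprod`, where it absorbs the rounding
  -- constants.
  have hDy : (p : ℝ) ^ (γ + ε / 2) = (p : ℝ) ^ γ * y ^ 2 := by rw [hy2, Real.rpow_add hp0]
  have hNγ : (p : ℝ) ^ γ * (p : ℝ) ^ (1 - γ) = p := by
    rw [← Real.rpow_add hp0, add_sub_cancel, Real.rpow_one]
  have hprod : (p : ℝ) ^ (1 - α) * (p : ℝ) ^ (α - γ - ε) * (p : ℝ) ^ (γ + ε / 2) * y ^ 2 = p := by
    rw [hy2, ← Real.rpow_add hp0, ← Real.rpow_add hp0, ← Real.rpow_add hp0]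
    conv_rhs => rw [← Real.rpow_one (p : ℝ)]
    congr 1
    ring
  have hγpos : 0 < (p : ℝ) ^ γ := Real.rpow_pos_of_pos hp0 _
  have hm' : (1 : ℝ) ≤ m := by exact_mod_cast hMpos
  have hD' : (1 : ℝ) ≤ D := by exact_mod_cast hDpos
  have hlog0 : 0 ≤ Real.log p := Real.log_natCast_nonneg p
  have hsmD : 2 * ((s : ℝ) * m * D) ≤ p := by
    calc 2 * ((s : ℝ) * m * D)
        ≤ 2 * (2 * (p : ℝ) ^ (1 - α) * (p : ℝ) ^ (α - γ - ε) * (p : ℝ) ^ (γ + ε / 2)) := by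
          gcongr
      _ = (p : ℝ) ^ (1 - α) * (p : ℝ) ^ (α - γ - ε) * (p : ℝ) ^ (γ + ε / 2) * 4 := by ring
      _ ≤ (p : ℝ) ^ (1 - α) * (p : ℝ) ^ (α - γ - ε) * (p : ℝ) ^ (γ + ε / 2) * y ^ 2 := by
          gcongr
          nlinarith only [hy4]
      _ = p := hprod
  refine ⟨by exact_mod_cast (by linarith : (0 : ℝ) < N), by exact_mod_cast (by linarith : (0 : ℝ) < s),
    hshi, hMpos, hMlo, hDpos, by exact_mod_cast hsmD, ?_, ?_⟩
  · have hsm0 : (1 : ℝ) ≤ (s : ℝ) * m := one_le_mul_of_one_le_of_one_le hs0 hm'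
    have hsm1 : (s : ℝ) * m ≤ p := by nlinarith only [hsm0, hD', hsmD]
    have hlog1 : Real.log ((s * m : ℕ) : ℝ) ≤ Real.log p := by
      rw [Nat.cast_mul]
      exact Real.log_le_log (by linarith) hsm1
    rw [div_mul_eq_mul_div, div_le_iff₀ (by linarith)]
    have h8 : 8 ≤ η * y := by
      rwa [div_le_iff₀ hη, mul_comm] at hyη
    calc (p : ℝ) * (1 + Real.log ((s * m : ℕ) : ℝ)) ≤ p * (2 * y) := by
          gcongr
          linarith
      _ ≤ p * (η * y ^ 2 / 4) := by
          gcongr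
          nlinarith only [mul_le_mul_of_nonneg_right h8 (by linarith only [hy4] : 0 ≤ y)]
      _ = η * ((p : ℝ) ^ (1 - γ) / 2) * ((p : ℝ) ^ γ * y ^ 2 / 2) := by
          conv_lhs => rw [← hNγ]
          ring
      _ ≤ η * N * D := by
          rw [hDy] at hDlo
          gcongr
  · have hN2 : (N : ℝ) ≤ p ^ 2 := by
      have : (p : ℝ) ^ (1 - γ) ≤ p := Real.rpow_le_self_of_one_le (by linarith) (by linarith)
      nlinarith only [this, hNhi, hp]
    have hlogN : Real.log N ≤ 2 * Real.log p := by
      have := Real.log_le_log (by linarith) hN2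
      rwa [Real.log_pow, Nat.cast_ofNat] at this
    have hlogN0 : 0 ≤ Real.log N := Real.log_natCast_nonneg N
    rw [div_le_div_iff₀ (by linarith) hp0]
    calc Real.log N ^ 2 * p ≤ (y / 2) ^ 2 * p := by
          gcongr
          linarith
      _ = ((p : ℝ) ^ γ * y ^ 2 / 2) * ((p : ℝ) ^ (1 - γ) / 2) := by
          conv_lhs => rw [← hNγ]
          ring
      _ ≤ D * N := by
          rw [hDy] at hDlo
          gcongr

/-- Below the detection boundary the risk of every test is at least `1 - o(1)`, uniformly. -/
theorem exists_tendsto_zero_one_sub_le_risk {γ α r : ℝ} (hγ₀ : 0 ≤ γ) (hγ₁ : γ < 1)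
    (hα₀ : (1 + γ) / 2 < α) (hα₁ : α < 1) (hr₀ : 0 ≤ r) (hr : r < rhoStar γ α) {p N s : ℕ → ℕ}
    (hN : Tendsto N atTop atTop)
    (hNp : ∀ n, |(N n : ℝ) - (p n : ℝ) ^ (1 - γ)| < 1)
    (hsp : ∀ n, |(s n : ℝ) - (p n : ℝ) ^ (1 - α)| < 1) :
    ∃ e : ℕ → ℝ, Tendsto e atTop (𝓝 0) ∧
      ∀ᶠ n in atTop, ∀ φ : Test (N n), 1 - e n ≤ risk (p n) (s n) r φ := by
  obtain ⟨η, hη, hrη⟩ : ∃ η > 0, r * (1 + η) < rhoStar γ α := by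
    -- The denominator uses `r + 1` so that `r = 0` is covered.
    refine ⟨(rhoStar γ α - r) / (2 * (r + 1)), div_pos (by linarith) (by linarith), ?_⟩
    have h1 : r / (r + 1) ≤ 1 := (div_le_one (by linarith)).2 (by linarith)
    have h2 : r * (1 + (rhoStar γ α - r) / (2 * (r + 1))) =
        r + r / (r + 1) * ((rhoStar γ α - r) / 2) := by field_simp
    rw [h2]
    nlinarith
  obtain ⟨hwv, hdense⟩ := lt_rhoStar_imp hα₀ hα₁ (by positivity) hrη
  have hu2 := Real.sq_sqrt (by linarith : 0 ≤ 1 - γ)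
  have hv2 := Real.sq_sqrt (by linarith : 0 ≤ 1 - α)
  have hw0 := Real.sqrt_nonneg (r * (1 + η))
  have hv0 := Real.sqrt_nonneg (1 - α)
  obtain ⟨c, hc, hneg⟩ := exists_chernoff_exponent_neg hwv hdense hv0
  set u := Real.sqrt (1 - γ)
  set v := Real.sqrt (1 - α)
  set w := Real.sqrt (r * (1 + η)) with hw
  set E := -2 * w ^ 2 + c * u + (4 * w - c) ^ 2 / 4 with hE
  -- The first bound keeps the exponent of `m` positive; the second spends at most half of the
  -- negative exponent on shrinking the blocks to `m ≈ p ^ (α - γ - ε)`.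
  set ε := min ((α - γ) / 2) (-(2 * v ^ 2 - u ^ 2 + E) / 2) with hεdef
  have hε : 0 < ε := lt_min (by linarith) (by linarith)
  have hε1 : ε ≤ (α - γ) / 2 := min_le_left _ _
  have hε2 : ε ≤ -(2 * v ^ 2 - u ^ 2 + E) / 2 := min_le_right _ _
  set δ₁ := -(2 * v ^ 2 - u ^ 2 + E + ε) with hδ₁def
  set δ₂ := (u - w) ^ 2 - v ^ 2 with hδ₂def
  have hδ₁ : 0 < δ₁ := by linarith
  have hδ₂ : 0 < δ₂ := by rw [hδ₂def]; nlinarith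
  have hp := tendsto_of_abs_sub_rpow_lt_one hγ₀ hγ₁ hN hNp
  have hpow : ∀ {b : ℝ}, 0 < b → Tendsto (fun n => (p n : ℝ) ^ b) atTop atTop :=
    fun hb => (tendsto_rpow_atTop hb).comp hp
  have hpow0 : ∀ {b : ℝ}, 0 < b → Tendsto (fun n => (p n : ℝ) ^ (-b)) atTop (𝓝 0) :=
    fun hb => (tendsto_rpow_neg_atTop hb).comp hp
  refine ⟨fun n => Real.sqrt (Real.exp (4 * (p n : ℝ) ^ (-δ₁)) +
    2 * (2 * (p n : ℝ) ^ (-δ₂)) - 1), ?_, ?_⟩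
  · have h1 : Tendsto (fun n => Real.exp (4 * (p n : ℝ) ^ (-δ₁)) +
        2 * (2 * (p n : ℝ) ^ (-δ₂)) - 1) atTop (𝓝 (Real.exp (4 * 0) + 2 * (2 * 0) - 1)) :=
      ((Real.continuous_exp.tendsto _).comp ((hpow0 hδ₁).const_mul 4)).add
        (((hpow0 hδ₂).const_mul 2).const_mul 2) |>.sub_const 1
    simpa [Function.comp_def] using (Real.continuous_sqrt.tendsto _).comp h1
  · have hlog : ∀ᶠ n in atTop, Real.log (p n) ≤ (p n : ℝ) ^ (ε / 4) / 4 := by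
      have h1 := hp.eventually
        ((isLittleO_log_rpow_atTop (by linarith : 0 < ε / 4)).bound (by norm_num : (0 : ℝ) < 1 / 4))
      filter_upwards [h1] with n hn
      rw [Real.norm_of_nonneg (by positivity : (0 : ℝ) ≤ (p n : ℝ) ^ (ε / 4))] at hn
      linarith [Real.le_norm_self (Real.log (p n))]
    filter_upwards [hlog, hp.eventually_ge_atTop 2,
      (hpow (by linarith : 0 < 1 - γ)).eventually_ge_atTop 2,
      (hpow (by linarith : 0 < 1 - α)).eventually_ge_atTop 2,
      (hpow (by linarith : 0 < ε / 4)).eventually_ge_atTop 4,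
      (hpow (by linarith : 0 < ε / 4)).eventually_ge_atTop (8 / η)]
      with n hlogn hp2 hpN hps hy4 hyη φ
    obtain ⟨hN0, hs0, hs, hm0, hm, hD0, hsmD, hgram, hsep⟩ :=
      grid_requirements hγ₀ hη hε (by linarith) hp2 (hNp n) (hsp n) hpN hps rfl hlogn hy4 hyη
    have hp0 : (0 : ℝ) < p n := by linarith
    have hL0 : 0 ≤ Real.log (p n) := Real.log_natCast_nonneg _
    have hL := Real.sq_sqrt hL0
    have ha : Real.sqrt (r * (1 + η) * Real.log (p n)) = w * Real.sqrt (Real.log (p n)) :=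
      Real.sqrt_mul (by positivity) _
    -- The level `t = √((1 - γ) log p)` is, to leading order, the maximum of about `N` real parts of
    -- pure noise.
    have hrisk := one_sub_sqrt_le_risk (r := r) (t := u * Real.sqrt (Real.log (p n)))
      (l := c * Real.sqrt (Real.log (p n))) hη.le hN0 (by exact_mod_cast hp0) hs0 hm0 hD0 hsmD
      hgram hsep (by rw [ha]; gcongr; linarith) (by positivity) φ
    refine le_trans (sub_le_sub_left (Real.sqrt_le_sqrt ?_) 1) hrisk
    set S := Real.sqrt (Real.log (p n))
    set m := ⌊(p n : ℝ) ^ (α - γ - ε)⌋₊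
    have h1 : Real.exp (-2 * Real.sqrt (r * (1 + η) * Real.log (p n)) ^ 2 + c * S * (u * S) +
        (4 * Real.sqrt (r * (1 + η) * Real.log (p n)) - c * S) ^ 2 / 4) = (p n : ℝ) ^ E := by
      rw [ha, Real.rpow_def_of_pos hp0, ← hL, hE]
      congr 1
      ring
    have h2 : Real.exp (-(u * S - Real.sqrt (r * (1 + η) * Real.log (p n))) ^ 2) =
        (p n : ℝ) ^ (-(u - w) ^ 2) := by
      rw [ha, Real.rpow_def_of_pos hp0, ← hL]
      congr 1
      ring
    rw [h1, h2]
    have hM0 : 0 < (p n : ℝ) ^ (α - γ - ε) := Real.rpow_pos_of_pos hp0 _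
    -- The exponents combine through `(1 - α) - (α - γ) = 2v² - u²`.
    have h3 : (s n : ℝ) * ((p n : ℝ) ^ E / m) ≤ 4 * (p n : ℝ) ^ (-δ₁) := by
      calc (s n : ℝ) * ((p n : ℝ) ^ E / m)
          ≤ 2 * (p n : ℝ) ^ (1 - α) * ((p n : ℝ) ^ E / ((p n : ℝ) ^ (α - γ - ε) / 2)) := by
            gcongr
        _ = 4 * ((p n : ℝ) ^ (1 - α) * (p n : ℝ) ^ E / (p n : ℝ) ^ (α - γ - ε)) := by
            field_simp
            norm_num
        _ = 4 * (p n : ℝ) ^ (-δ₁) := by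
            rw [← Real.rpow_add hp0, ← Real.rpow_sub hp0, hδ₁def, hu2, hv2]
            congr 2
            ring
    have h4 : (s n : ℝ) * (p n : ℝ) ^ (-(u - w) ^ 2) ≤ 2 * (p n : ℝ) ^ (-δ₂) := by
      calc (s n : ℝ) * (p n : ℝ) ^ (-(u - w) ^ 2)
          ≤ 2 * (p n : ℝ) ^ (1 - α) * (p n : ℝ) ^ (-(u - w) ^ 2) := by gcongr
        _ = 2 * (p n : ℝ) ^ (-δ₂) := by
            rw [mul_assoc, ← Real.rpow_add hp0, hδ₂def, hv2]
            congr 2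
            ring
    gcongr

end EDFT

/-! ### Limits of the risk -/

theorem theorem2p2 (γ α r : ℝ) (hγ₀ : 0 ≤ γ) (hγ₁ : γ < 1)
    (hα₀ : (1 + γ) / 2 < α) (hα₁ : α < 1)
    (hr₀ : 0 ≤ r) (hr : r < EDFT.rhoStar γ α)
    (p N s : ℕ → ℕ)
    (hN : Tendsto N atTop atTop)
    (hNp : ∀ n, |(N n : ℝ) - (p n : ℝ) ^ (1 - γ)| < 1)
    (hsp : ∀ n, |(s n : ℝ) - (p n : ℝ) ^ (1 - α)| < 1) :
    (∀ φ : (n : ℕ) → EDFT.Test (N n),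
      1 ≤ liminf (fun n => EDFT.risk (p n) (s n) r (φ n)) atTop ∧
      (limsup (fun n => EDFT.risk (p n) (s n) r (φ n)) atTop ≤ 1 →
        Tendsto (fun n => EDFT.risk (p n) (s n) r (φ n)) atTop (𝓝 1))) ∧
    Tendsto (fun n => ⨅ φ : EDFT.Test (N n), EDFT.risk (p n) (s n) r φ) atTop (𝓝 1) := by
  obtain ⟨e, he, hrisk⟩ := EDFT.exists_tendsto_zero_one_sub_le_risk hγ₀ hγ₁ hα₀ hα₁ hr₀ hr hN hNp hsp
  have he1 : Tendsto (fun n => 1 - e n) atTop (𝓝 1) := by simpa using he.const_sub 1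
  refine ⟨fun φ => ?_, ?_⟩
  -- Real `liminf` and `limsup` are meaningful only for bounded sequences; the risk lies between 0
  -- and 2.
  · have hup : IsBoundedUnder (· ≤ ·) atTop fun n => EDFT.risk (p n) (s n) r (φ n) :=
      isBoundedUnder_of ⟨2, fun n => EDFT.risk_le_two _ _ _ _⟩
    have hlo : IsBoundedUnder (· ≥ ·) atTop fun n => EDFT.risk (p n) (s n) r (φ n) :=
      isBoundedUnder_of ⟨0, fun n => EDFT.risk_nonneg _ _ _ _⟩
    have hliminf : 1 ≤ liminf (fun n => EDFT.risk (p n) (s n) r (φ n)) atTop := by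
      rw [← he1.liminf_eq]
      exact liminf_le_liminf (hrisk.mono fun n hn => hn (φ n)) he1.isBoundedUnder_ge
        hup.isCoboundedUnder_ge
    exact ⟨hliminf, fun hlimsup => tendsto_of_le_liminf_of_limsup_le hliminf hlimsup hup hlo⟩
  · refine tendsto_of_tendsto_of_tendsto_of_le_of_le' he1 tendsto_const_nhds ?_ ?_
    · filter_upwards [hrisk] with n hn
      have : Nonempty (EDFT.Test (N n)) := ⟨EDFT.acceptTest (N n)⟩
      exact le_ciInf hn
    -- The upper bound for the minimal risk comes from never rejecting, which has no type I error.
    · refine .of_forall fun n => (ciInf_le ⟨0, ?_⟩ (EDFT.acceptTest (N n))).trans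
        (EDFT.risk_acceptTest_le _ _ _ _)
      rintro _ ⟨φ, rfl⟩
      exact EDFT.risk_nonneg _ _ _ _
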